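/- **Scenario.** Let $d\ge 2$, $\omega=e^{2\pi i/d}$, $Z_d=\sum_i\omega^i|i\rangle\langle i|$, $X_d=\sum_i|i+1\rangle\langle i|$ (addition mod $d$). Alice (trusted) holds $\mathbb C^d$ and measures the $d^2$ $d$-outcome observables $A_{(i,j)}=e^{i\pi\, ij(d-1)/d}X_d^iZ_d^j$, $0\le i,j<d$ (the phase makes $A_{(i,j)}^d=\mathbb 1$; it is $1$ for $Z_d$ and $X_d$). A realization consists of finite-dimensional spaces $\mathcal H_B,\mathcal H_E$, a state (density operator) $\rho_{ABE}$ on $\mathbb C^d\otimes\mathcal H_B\otimes\mathcal H_E$, two $d$-outcome POVMs $\{N_{b|0}\},\{N_{b|1}\}$ and a third, $d^2$-outcome POVM $\{R_b\}$ (setting $y=2$) of Bob. It produces the correlations $\vec p=\{p(a,b|x,y)\}$ of Alice and Bob by the Born rule. Let $\alpha_0,\dots,\alpha_{d-1}>0$, $\sum_i\alpha_i^2=1$, $|\psi(\boldsymbol\alpha)\rangle=\sum_i\alpha_i|i\rangle|i\rangle$, $\rho_B(\boldsymbol\alpha)=\operatorname{Tr}_A|\psi(\boldsymbol\alpha)\rangle\langle\psi(\boldsymbol\alpha)|$.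 With $B_{k|y}=\sum_b\omega^{kb}N_{b|y}$, the steering functional is $$\mathcal B_d(\boldsymbol\alpha)=\sum_{k=1}^{d-1}\Big\langle Z_d^k\otimes B_{k|0}+\gamma\,X_d^k\otimes B_{k|1}+\delta_k Z_d^k\Big\rangle,\quad \gamma=\frac{d}{\sum_{i\neq j}\alpha_i/\alpha_j},\quad \delta_k=-\frac{\gamma}{d}\sum_{i\ne j}\frac{\alpha_i}{\alpha_j}\omega^{k(d-j)}.$$ Let $\{\mathcal I_b\}$ be an extremal $d^2$-outcome POVM on $\mathbb C^d$ (not a nontrivial convex mixture of POVMs). Say that a realization is *certified* by $(\boldsymbol\alpha,\mathcal I)$ if its correlations attain the maximum of $\mathcal B_d(\boldsymbol\alpha)$ over all realizations and $$\operatorname{Tr}[\rho_{ABE}(X_d^iZ_d^j\otimes R_b\otimes\mathbb 1_E)]=\langle\psi(\boldsymbol\alpha)|X_d^iZ_d^j\otimes\mathcal I_b|\psi(\boldsymbol\alpha)\rangle\qquad\text{for all } i,j,b .$$ Eve's guessing probability for Bob's third measurement is $$G(y=2,\vec p)=\sup\ \sum_b\operatorname{Tr}[\rho_{ABE}(\mathbb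 1\otimes R_b\otimes E_b)],$$ the supremum being over all realizations that reproduce $\vec p$ and all POVMs $\{E_b\}$ on $\mathcal H_E$; and $H_{\min}=-\log_2 G(y=2,\vec p)$. **Theorem.** (a) For all such $\boldsymbol\alpha$ and $\{\mathcal I_b\}$ certified realizations exist, and for the correlations $\vec p$ of any certified realization $$G(y=2,\vec p)=\sup_{\sigma_E,\{E_b\}}\sum_b\operatorname{Tr}[\mathcal I_b\,\rho_B(\boldsymbol\alpha)]\operatorname{Tr}[E_b\sigma_E],$$ where $\sigma_E$ ranges over finite-dimensional states and $\{E_b\}$ over POVMs. If moreover $\operatorname{Tr}[\mathcal I_b\,\rho_B(\boldsymbol\alpha)]=1/d^2$ for every $b$, then every strategy (realization reproducing $\vec p$, with any measurement of Eve) guesses correctly with probability exactly $1/d^2$; hence $G(y=2,\vec p)=1/d^2$ and $H_{\min}=2\log_2 d$ bits are certified. (b) For every $d\ge2$ this applies to the maximally entangled state, $\alpha_i=1/\sqrt d$ for all $i$: there is a unit vector $|\nu\rangle\in\mathbb C^d$ with $\operatorname{Tr}[(X_d^kZ_d^l)^\dagger|\nu\rangle\langle\nu|]\neq0$ for all $0\le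 k,l<d$, and for every such $|\nu\rangle$ the operators $\mathcal I_{k,l}=\frac1d X_d^kZ_d^l|\nu\rangle\langle\nu|(X_d^kZ_d^l)^\dagger$ form an extremal $d^2$-outcome POVM with $\operatorname{Tr}[\mathcal I_{k,l}\rho_B(\boldsymbol\alpha)]=1/d^2$ for all $k,l$; certified realizations exist for it, and each of them has $G(y=2,\vec p)=1/d^2$ and $H_{\min}=2\log_2 d$. -/

import Mathlib

open scoped Matrix Kronecker ComplexOrder

noncomputable section

namespace Steering

/-! ### States and measurements on finite-dimensional systems -/

/-- `ρ` is a density matrix: positive semidefinite of trace one. -/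
def IsDensity {n : Type*} [Fintype n] (ρ : Matrix n n ℂ) : Prop :=
  ρ.PosSemidef ∧ ρ.trace = 1

/-- The POVMs with outcome set `o` on the Hilbert space `ℂ^n`: families of positive semidefinite
matrices that sum to the identity. -/
def povms (o n : Type*) [Fintype o] [Fintype n] [DecidableEq n] : Set (o → Matrix n n ℂ) :=
  {N | (∀ b, (N b).PosSemidef) ∧ ∑ b, N b = 1}

/-- `N` is an extremal POVM: it is not a nontrivial convex mixture of POVMs with the same
outcome set on the same space. -/
def IsExtremalPOVM {o n : Type*} [Fintype o] [Fintype n] [DecidableEq n]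
    (N : o → Matrix n n ℂ) : Prop :=
  N ∈ (povms o n).extremePoints ℝ

/-- The rank-one operator `|v⟩⟨v|`. -/
def ketbra {n : Type*} (v : n → ℂ) : Matrix n n ℂ := Matrix.vecMulVec v (star v)

/-- The expectation value `⟨v| O |v⟩`. -/
def expect {n : Type*} [Fintype n] (O : Matrix n n ℂ) (v : n → ℂ) : ℂ :=
  star v ⬝ᵥ (O *ᵥ v)

/-- The partial trace over the first tensor factor. -/
def traceFirst {m n : Type*} [Fintype m] (ρ : Matrix (m × n) (m × n) ℂ) : Matrix n n ℂ :=
  fun b b' => ∑ a, ρ (a, b) (a, b')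

/-! ### The operators `X_d`, `Z_d` and Alice's trusted observables -/

/-- `ω = exp(2πi/d)`. -/
def omega (d : ℕ) : ℂ := Complex.exp (2 * Real.pi * Complex.I / d)

/-- `Z_d = ∑ i, ω^i |i⟩⟨i|`. -/
def Zd (d : ℕ) : Matrix (Fin d) (Fin d) ℂ := Matrix.diagonal fun i => omega d ^ (i : ℕ)

/-- `X_d = ∑ i, |i+1⟩⟨i|`, with addition modulo `d`. -/
def Xd (d : ℕ) [NeZero d] : Matrix (Fin d) (Fin d) ℂ :=
  Matrix.of fun r c => if r = c + 1 then 1 else 0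

/-- The operator `X_d^i Z_d^j`, indexed by `x = (i, j)`. -/
def weyl (d : ℕ) [NeZero d] (x : Fin d × Fin d) : Matrix (Fin d) (Fin d) ℂ :=
  Xd d ^ (x.1 : ℕ) * Zd d ^ (x.2 : ℕ)

/-- The `d`-outcome observable of Alice built from `X_d^i Z_d^j`. Since
`(X_d^i Z_d^j)^d = (-1)^(i j (d-1))`, the scalar phase `exp(πi/d)^(i j (d-1))` makes its `d`-th
power the identity; the phase is `1` for `Z_d` (index `(0,1)`) and `X_d` (index `(1,0)`). -/
def aliceObs (d : ℕ) [NeZero d] (x : Fin d × Fin d) : Matrix (Fin d) (Fin d) ℂ :=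
  Complex.exp (Real.pi * Complex.I / d) ^ ((x.1 : ℕ) * (x.2 : ℕ) * (d - 1)) • weyl d x

/-- Alice's measurement operators `M_{a|x} = (1/d) ∑ k, ω^(-a k) A_x^k`, the projections onto the
eigenspaces of `A_x` with eigenvalue `ω^a`. -/
def aliceMeas (d : ℕ) [NeZero d] (x : Fin d × Fin d) (a : Fin d) : Matrix (Fin d) (Fin d) ℂ :=
  (d : ℂ)⁻¹ • ∑ k : Fin d, ((omega d)⁻¹ ^ ((a : ℕ) * (k : ℕ))) • aliceObs d x ^ (k : ℕ)

/-! ### Realizations and correlations -/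

/-- A quantum realization of the scenario: finite-dimensional Hilbert spaces of Bob and Eve,
an arbitrary (possibly mixed) state of Alice, Bob and Eve, two `d`-outcome POVMs of Bob
(`y = 0, 1`) and a third POVM of Bob (`y = 2`) with outcome set `ι`. Alice's space is `ℂ^d`. -/
structure Realization (d : ℕ) (ι : Type) [Fintype ι] where
  dimB : ℕ
  dimE : ℕ
  ρ : Matrix (Fin d × (Fin dimB × Fin dimE)) (Fin d × (Fin dimB × Fin dimE)) ℂ
  isDensity : IsDensity ρ
  N : Fin 2 → Fin d → Matrix (Fin dimB) (Fin dimB) ℂ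
  N_mem : ∀ y, N y ∈ povms (Fin d) (Fin dimB)
  R : ι → Matrix (Fin dimB) (Fin dimB) ℂ
  R_mem : R ∈ povms ι (Fin dimB)

/-- The correlations `p(a,b|x,y)` of Alice and Bob: `first x y a b` for Bob's first two
measurements, `third x a b` for his third one. Alice's settings `x` are her `d²` observables. -/
@[ext] structure Correlations (d : ℕ) (ι : Type) where
  first : Fin d × Fin d → Fin 2 → Fin d → Fin d → ℝ
  third : Fin d × Fin d → Fin d → ι → ℝ

/-- `Tr[ρ_ABE (O_A ⊗ O_B ⊗ O_E)]`. -/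
def Realization.tr {d : ℕ} {ι : Type} [Fintype ι] (Q : Realization d ι)
    (A : Matrix (Fin d) (Fin d) ℂ) (B : Matrix (Fin Q.dimB) (Fin Q.dimB) ℂ)
    (E : Matrix (Fin Q.dimE) (Fin Q.dimE) ℂ) : ℂ :=
  (Q.ρ * (A ⊗ₖ (B ⊗ₖ E))).trace

/-- The correlations produced by a realization (Born rule; Eve's system is traced out). -/
def Realization.corr {d : ℕ} [NeZero d] {ι : Type} [Fintype ι] (Q : Realization d ι) :
    Correlations d ι where
  first x y a b := (Q.tr (aliceMeas d x a) (Q.N y b) 1).re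
  third x a b := (Q.tr (aliceMeas d x a) (Q.R b) 1).re

/-! ### The steering inequality -/

/-- The generalized expectation value `⟨A_{k|x} B_{l|y}⟩ = ∑ a b, ω^(a k + b l) p(a,b|x,y)`. -/
def Correlations.gexp {d : ℕ} {ι : Type} (p : Correlations d ι) (x : Fin d × Fin d) (y : Fin 2)
    (k l : ℕ) : ℂ :=
  ∑ a : Fin d, ∑ b : Fin d, omega d ^ ((a : ℕ) * k + (b : ℕ) * l) * (p.first x y a b : ℂ)

/-- `γ(α) = d / ∑_{i ≠ j} α_i / α_j`. -/
def gammaCoeff {d : ℕ} (α : Fin d → ℝ) : ℝ :=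
  d / ∑ ij ∈ (Finset.univ : Finset (Fin d)).offDiag, α ij.1 / α ij.2

/-- `δ_k(α) = -(γ(α)/d) ∑_{i ≠ j} (α_i / α_j) ω^(k (d - j))`. -/
def deltaCoeff {d : ℕ} (α : Fin d → ℝ) (k : ℕ) : ℂ :=
  -((gammaCoeff α : ℂ) / d) * ∑ ij ∈ (Finset.univ : Finset (Fin d)).offDiag,
    ((α ij.1 / α ij.2 : ℝ) : ℂ) * omega d ^ (k * (d - (ij.2 : ℕ)))

/-- The value of the steering functional
`B_d(α) = ∑_{k=1}^{d-1} ⟨A_0^k ⊗ B_{k|0} + γ(α) A_1^k ⊗ B_{k|1} + δ_k(α) A_0^k⟩`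
with `A_0 = Z_d` and `A_1 = X_d`. The sum is real for quantum correlations. -/
def steeringValue {d : ℕ} [NeZero d] {ι : Type} (α : Fin d → ℝ) (p : Correlations d ι) : ℝ :=
  (∑ k ∈ Finset.Ico 1 d,
    (p.gexp (0, 1) 0 k k + (gammaCoeff α : ℂ) * p.gexp (1, 0) 1 k k
      + deltaCoeff α k * p.gexp (0, 1) 0 k 0)).re

/-- The correlations `p` violate the steering inequality maximally: the value of the steering
functional at `p` is the greatest one among all quantum realizations. -/
def MaximallyViolates {d : ℕ} [NeZero d] {ι : Type} [Fintype ι] (α : Fin d → ℝ)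
    (p : Correlations d ι) : Prop :=
  IsGreatest {v : ℝ | ∃ Q : Realization d ι, v = steeringValue α Q.corr} (steeringValue α p)

/-! ### The reference state and the POVM-certification conditions -/

/-- `|ψ(α)⟩ = ∑ i, α_i |i⟩|i⟩`. -/
def psi {d : ℕ} (α : Fin d → ℝ) : Fin d × Fin d → ℂ :=
  fun s => if s.1 = s.2 then (α s.1 : ℂ) else 0

/-- Bob's reduced state `ρ_B(α) = Tr_A |ψ(α)⟩⟨ψ(α)|`. -/
def rhoB {d : ℕ} (α : Fin d → ℝ) : Matrix (Fin d) (Fin d) ℂ := traceFirst (ketbra (psi α))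

/-- `α` is a vector of `d` positive, normalized Schmidt coefficients. -/
def IsSchmidt {d : ℕ} (α : Fin d → ℝ) : Prop := (∀ i, 0 < α i) ∧ ∑ i, α i ^ 2 = 1

/-- The assumptions of the certification scheme: maximal violation of the steering inequality
for `α`, and `⟨X_d^i Z_d^j ⊗ R_b ⊗ 1_E⟩ = ⟨X_d^i Z_d^j ⊗ I_b⟩_{ψ(α)}` for all `i, j, b`. -/
structure Realization.CertifiedBy {d : ℕ} [NeZero d] {ι : Type} [Fintype ι] (Q : Realization d ι)
    (α : Fin d → ℝ) (I : ι → Matrix (Fin d) (Fin d) ℂ) : Prop where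
  maximal : MaximallyViolates α Q.corr
  povm : ∀ (x : Fin d × Fin d) (b : ι),
    Q.tr (weyl d x) (Q.R b) 1 = expect (weyl d x ⊗ₖ I b) (psi α)

/-! ### Eve's guessing probability for Bob's third measurement -/

/-- The probability `∑ b, Tr[ρ_ABE (1 ⊗ R_b ⊗ E_b)]` that Eve, measuring `E`, guesses the outcome
of Bob's third measurement. -/
def Realization.guess {d : ℕ} {ι : Type} [Fintype ι] (Q : Realization d ι)
    (E : ι → Matrix (Fin Q.dimE) (Fin Q.dimE) ℂ) : ℝ :=
  ∑ b, (Q.tr 1 (Q.R b) (E b)).re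

/-- The guessing probability `G(y = 2, p)`: the supremum over all strategies (a realization that
reproduces the correlations `p`, and a measurement of Eve). -/
def guessingProb {d : ℕ} [NeZero d] {ι : Type} [Fintype ι] (p : Correlations d ι) : ℝ :=
  sSup {g : ℝ | ∃ (Q : Realization d ι) (E : ι → Matrix (Fin Q.dimE) (Fin Q.dimE) ℂ),
    Q.corr = p ∧ E ∈ povms ι (Fin Q.dimE) ∧ g = Q.guess E}

/-- The min-entropy `H_min = -log₂ G`, the number of certified random bits. -/
def minEntropy {d : ℕ} [NeZero d] {ι : Type} [Fintype ι] (p : Correlations d ι) : ℝ :=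
  -Real.logb 2 (guessingProb p)

/-- The supremum over all states `σ_E` and measurements `E` of Eve of
`∑ b, Tr[I_b ρ_B(α)] Tr[E_b σ_E]`. -/
def reducedGuessingProb {d : ℕ} {ι : Type} [Fintype ι] (α : Fin d → ℝ)
    (I : ι → Matrix (Fin d) (Fin d) ℂ) : ℝ :=
  sSup {g : ℝ | ∃ (n : ℕ) (σ : Matrix (Fin n) (Fin n) ℂ) (E : ι → Matrix (Fin n) (Fin n) ℂ),
    IsDensity σ ∧ E ∈ povms ι (Fin n) ∧
      g = (∑ b, (I b * rhoB α).trace * (E b * σ).trace).re}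

/-! ### The Weyl-covariant POVM -/

/-- Schmidt coefficients `1/√d` of the maximally entangled state. -/
def maxEnt (d : ℕ) : Fin d → ℝ := fun _ => 1 / √(d : ℝ)

/-- `I_{k,l} = (1/d) U_{k,l} |ν⟩⟨ν| U_{k,l}†` with `U_{k,l} = X_d^k Z_d^l`. -/
def weylPOVM {d : ℕ} [NeZero d] (ν : Fin d → ℂ) (x : Fin d × Fin d) : Matrix (Fin d) (Fin d) ℂ :=
  (d : ℂ)⁻¹ • (weyl d x * ketbra ν * (weyl d x)ᴴ)

/-- `ν` is a unit vector with `Tr[U_{k,l}† |ν⟩⟨ν|] ≠ 0` for all `k, l`. -/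
def IsFiducial {d : ℕ} [NeZero d] (ν : Fin d → ℂ) : Prop :=
  star ν ⬝ᵥ ν = 1 ∧ ∀ x : Fin d × Fin d, ((weyl d x)ᴴ * ketbra ν).trace ≠ 0

end Steering

end

/-! Everything is read off from the unnormalized operators that Bob and Eve steer on Alice's side:
`steered ρ (B ⊗ₖ E)` is linear in the effects and positive on positive effects.

Rigidity. Fourier summation over `k` turns `d` minus the steering value into a sum of two
nonnegative terms (`sub_steeringValue_eq`): the weight of the operators for `y = 0` off the basis
vectors `|-b⟩`, and `γ` times the `steeringGap` of the operators for `y = 1`. The gap is the trace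
against a weighted Laplacian of the complete graph (`steeringGap_eq`), hence nonnegative. So `d` is
an upper bound. The state `ψ(α)` attains it, and at the maximum every term vanishes. Since `N ⊗ 1 =
N ⊗ E + N ⊗ (1 - E)` with both parts positive, the vanishing survives conditioning on any effect `E`
of Eve. Hence Alice's state conditioned on `E` is a multiple of `diag(α²)`
(`Realization.steered_one_eq`): the case `y = 0` makes it diagonal, the case `y = 1` fixes the
ratios on the diagonal.

Decoupling. The tomographic data give `steered ρ (R_b ⊗ 1) = twist α (I_b)`. Conditioning on `E` of
probability `q` and undoing `twist` gives positive operators that sum to `q • 1`. Their deviations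
from `q • I_b` sum to zero and can be added to and subtracted from `I` without losing positivity, so
extremality makes them zero (`steered_R_eq`). Bob's third outcome is therefore independent of Eve,
which bounds her guess; conversely an uncorrelated system can be handed to Eve without changing `p`.

Weyl POVM. Linearly independent rank-one effects are extremal. Independence of the orbit of `ν` is a
deconvolution problem on `(ℤ/d)²`, solvable because the Fourier coefficients `overlap ν m l` do not
vanish. A small perturbation of `|0⟩`, normalized, satisfies this condition. -/

noncomputable section

namespace Steering

/-! ### Roots of unity -/

section Fourier

variable {d : ℕ}

/-- The character `c ↦ ω^(j c)` of `ℤ/d`. -/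
def chi (j c : Fin d) : ℂ := omega d ^ ((j : ℕ) * (c : ℕ))

theorem chi_comm (j c : Fin d) : chi j c = chi c j := by rw [chi, chi, mul_comm]

theorem chi_inv_eq_pow (j a : Fin d) : (chi j a)⁻¹ = (omega d)⁻¹ ^ ((j : ℕ) * (a : ℕ)) := by
  rw [chi, inv_pow]

theorem star_omega : star (omega d) = (omega d)⁻¹ := by
  rw [omega, ← Complex.exp_neg, Complex.star_def, ← Complex.exp_conj]
  congr 1
  simp [neg_div, Complex.conj_ofNat]

theorem star_chi (j a : Fin d) : star (chi j a) = (chi j a)⁻¹ := by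
  rw [chi, star_pow, star_omega, inv_pow]

theorem Zd_pow (n : ℕ) :
    Zd d ^ n = Matrix.diagonal fun i : Fin d => omega d ^ ((i : ℕ) * n) := by
  rw [Zd, Matrix.diagonal_pow]
  simp [pow_mul, Pi.pow_def]

variable [NeZero d]

theorem isPrimitiveRoot_omega : IsPrimitiveRoot (omega d) d :=
  Complex.isPrimitiveRoot_exp d (NeZero.ne d)

theorem omega_pow_self : omega d ^ d = 1 := isPrimitiveRoot_omega.pow_eq_one

theorem omega_ne_zero : omega d ≠ 0 := isPrimitiveRoot_omega.ne_zero (NeZero.ne d)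

theorem omega_pow_mod (n : ℕ) : omega d ^ (n % d) = omega d ^ n := by
  conv_rhs => rw [← Nat.mod_add_div n d, pow_add, pow_mul, omega_pow_self, one_pow, mul_one]

theorem omega_pow_val_add (a b : Fin d) :
    omega d ^ ((a + b : Fin d) : ℕ) = omega d ^ ((a : ℕ) + (b : ℕ)) := by
  rw [Fin.val_add, omega_pow_mod]

theorem chi_ne_zero (j c : Fin d) : chi j c ≠ 0 := pow_ne_zero _ omega_ne_zero

theorem chi_add (j a b : Fin d) : chi j (a + b) = chi j a * chi j b := by
  rw [chi, mul_comm, pow_mul, omega_pow_val_add, ← pow_mul, add_mul, pow_add, mul_comm (a : ℕ),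
    mul_comm (b : ℕ), chi, chi]

@[simp] theorem chi_zero (j : Fin d) : chi j 0 = 1 := by simp [chi]

@[simp] theorem chi_zero_left (j : Fin d) : chi 0 j = 1 := by simp [chi]

theorem chi_neg (j a : Fin d) : chi j (-a) = (chi j a)⁻¹ := by
  refine eq_inv_of_mul_eq_one_left ?_
  rw [← chi_add, neg_add_cancel, chi_zero]

theorem chi_sub (j a b : Fin d) : chi j (a - b) = chi j a * (chi j b)⁻¹ := by
  rw [sub_eq_add_neg, chi_add, chi_neg]

theorem sum_chi (a : Fin d) : ∑ j : Fin d, chi j a = if a = 0 then (d : ℂ) else 0 := by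
  split_ifs with h
  · simp [h]
  · have h1 : omega d ^ (a : ℕ) ≠ 1 := by
      intro h1
      have := (isPrimitiveRoot_omega (d := d)).dvd_of_pow_eq_one _ h1
      exact h (Fin.ext (by simpa using Nat.eq_zero_of_dvd_of_lt this a.2))
    have h2 : ∑ j : Fin d, chi j a = ∑ j ∈ Finset.range d, (omega d ^ (a : ℕ)) ^ j := by
      rw [← Fin.sum_univ_eq_sum_range (fun j => (omega d ^ (a : ℕ)) ^ j)]
      refine Finset.sum_congr rfl fun j _ => ?_
      rw [chi, ← pow_mul, mul_comm]
    rw [h2, geom_sum_eq h1, ← pow_mul, mul_comm, pow_mul, omega_pow_self]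
    simp

theorem sum_chi_mul_inv (a b : Fin d) :
    ∑ j : Fin d, chi j a * (chi j b)⁻¹ = if a = b then (d : ℂ) else 0 := by
  simp_rw [← chi_sub, sum_chi, sub_eq_zero]

theorem eq_zero_of_sum_chi (h : Fin d → ℂ) (h0 : ∀ j, ∑ c, h c * chi j c = 0) : h = 0 := by
  funext b
  have h1 : ∑ j, (∑ c, h c * chi j c) * (chi j b)⁻¹ = 0 := by simp [h0]
  simp_rw [Finset.sum_mul, mul_assoc] at h1
  rw [Finset.sum_comm] at h1
  simp_rw [← Finset.mul_sum, sum_chi_mul_inv] at h1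
  simpa [NeZero.ne d] using h1

end Fourier

/-! ### The operators `X^i Z^j` -/

section Weyl

variable {d : ℕ}

/-- The phase that turns `X^i Z^j` into the observable `A_(i,j)`. -/
def phase (d : ℕ) (x : Fin d × Fin d) : ℂ :=
  Complex.exp (Real.pi * Complex.I / d) ^ ((x.1 : ℕ) * (x.2 : ℕ) * (d - 1))

theorem phase_ne_zero (x : Fin d × Fin d) : phase d x ≠ 0 := pow_ne_zero _ (Complex.exp_ne_zero _)

theorem star_phase_mul (x : Fin d × Fin d) : star (phase d x) * phase d x = 1 := by
  rw [phase, star_pow, ← mul_pow, Complex.star_def, ← Complex.exp_conj, ← Complex.exp_add]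
  simp [neg_div]

variable [NeZero d]

theorem val_nsmul_one (n : ℕ) : ((n • (1 : Fin d) : Fin d) : ℕ) = n % d := by
  induction n with
  | zero => simp
  | succ n ih =>
    rw [succ_nsmul, Fin.val_add, ih, Fin.val_one', ← Nat.add_mod]

theorem val_nsmul_one_self (i : Fin d) : (i : ℕ) • (1 : Fin d) = i :=
  Fin.ext (by rw [val_nsmul_one, Nat.mod_eq_of_lt i.2])

theorem Xd_pow_apply (n : ℕ) (r c : Fin d) :
    (Xd d ^ n) r c = if r = c + n • (1 : Fin d) then 1 else 0 := by
  induction n generalizing c with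
  | zero => simp [Matrix.one_apply]
  | succ n ih =>
    rw [pow_succ, Matrix.mul_apply]
    have h : ∀ k, Xd d k c = if k = c + 1 then 1 else 0 := fun _ => rfl
    simp [ih, h, succ_nsmul', add_assoc]

theorem weyl_apply (x : Fin d × Fin d) (r c : Fin d) :
    weyl d x r c = if r = c + x.1 then chi x.2 c else 0 := by
  rw [weyl, Zd_pow, Matrix.mul_diagonal, Xd_pow_apply, val_nsmul_one_self, chi, mul_comm (x.2 : ℕ)]
  split_ifs <;> simp

theorem trace_mul_weyl (G : Matrix (Fin d) (Fin d) ℂ) (x : Fin d × Fin d) :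
    (G * weyl d x).trace = ∑ c, G c (c + x.1) * chi x.2 c := by
  rw [Matrix.trace_mul_comm, Matrix.trace]
  simp only [Matrix.diag_apply, Matrix.mul_apply, weyl_apply]
  rw [Finset.sum_comm]
  simp [mul_comm]

/-- Tomographic completeness: for fixed `i`, the traces against `X^i Z^j` are the Fourier
coefficients of the cyclic diagonal `c ↦ G c (c + i)`, and these diagonals exhaust the matrix. -/
theorem eq_of_trace_mul_weyl {G H : Matrix (Fin d) (Fin d) ℂ}
    (h : ∀ x, (G * weyl d x).trace = (H * weyl d x).trace) : G = H := by
  ext a b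
  have := eq_zero_of_sum_chi (fun c => (G - H) c (c + (b - a))) (fun j => by
    rw [← trace_mul_weyl (G - H) (b - a, j), Matrix.sub_mul, Matrix.trace_sub, h, sub_self])
  have := congrFun this a
  simpa [sub_eq_zero] using this

theorem Zd_mul_Xd : Zd d * Xd d = omega d • (Xd d * Zd d) := by
  ext r c
  simp only [Zd, Xd, Matrix.diagonal_mul, Matrix.smul_apply, Matrix.mul_diagonal, Matrix.of_apply,
    smul_eq_mul]
  split_ifs with h
  · rw [h, omega_pow_val_add, pow_add, mul_one, one_mul, mul_comm]
    congr 1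
    rw [Fin.val_one', omega_pow_mod, pow_one]
  · simp

theorem Zd_pow_mul_Xd_pow (i j : ℕ) :
    Zd d ^ j * Xd d ^ i = omega d ^ (i * j) • (Xd d ^ i * Zd d ^ j) := by
  have h1 : ∀ j : ℕ, Zd d ^ j * Xd d = omega d ^ j • (Xd d * Zd d ^ j) := by
    intro j
    induction j with
    | zero => simp
    | succ j ih =>
      rw [pow_succ', mul_assoc, ih, Matrix.mul_smul, ← mul_assoc, Zd_mul_Xd, Matrix.smul_mul,
        smul_smul, mul_assoc, pow_succ]
  induction i with
  | zero => simp
  | succ i ih =>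
    rw [pow_succ, ← mul_assoc, ih, Matrix.smul_mul, mul_assoc, h1, Matrix.mul_smul, smul_smul,
      ← mul_assoc, ← pow_add, add_mul, one_mul]

theorem Xd_pow_mul_Zd_pow_pow (i j n : ℕ) :
    (Xd d ^ i * Zd d ^ j) ^ n =
      omega d ^ (i * j * n.choose 2) • (Xd d ^ (i * n) * Zd d ^ (j * n)) := by
  induction n with
  | zero => simp
  | succ n ih =>
    have h : Xd d ^ (i * n) * Zd d ^ (j * n) * (Xd d ^ i * Zd d ^ j) =
        omega d ^ (i * (j * n)) • (Xd d ^ (i * (n + 1)) * Zd d ^ (j * (n + 1))) := by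
      rw [mul_assoc, ← mul_assoc (Zd d ^ (j * n)), Zd_pow_mul_Xd_pow, Matrix.smul_mul,
        Matrix.mul_smul, mul_assoc, ← mul_assoc (Xd d ^ (i * n)), ← pow_add, ← pow_add]
      rfl
    rw [pow_succ, ih, Matrix.smul_mul, h, smul_smul, ← pow_add, Nat.choose_succ_succ' n 1,
      Nat.choose_one_right]
    congr 2
    ring

theorem Xd_pow_self : Xd d ^ d = 1 := by
  ext r c
  rw [Xd_pow_apply, Matrix.one_apply]
  have : d • (1 : Fin d) = 0 := Fin.ext (by rw [val_nsmul_one]; simp)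
  rw [this, add_zero]

theorem Zd_pow_self : Zd d ^ d = 1 := by
  rw [Zd_pow]
  simp [mul_comm _ d, pow_mul, omega_pow_self]

theorem conjTranspose_Xd_mul : (Xd d)ᴴ * Xd d = 1 := by
  ext r c
  simp [Matrix.mul_apply, Xd, Matrix.one_apply, eq_comm]

theorem conjTranspose_Zd_mul : (Zd d)ᴴ * Zd d = 1 := by
  rw [Zd, Matrix.diagonal_conjTranspose, Matrix.diagonal_mul_diagonal, ← Matrix.diagonal_one]
  congr 1
  funext i
  simp [star_omega, omega_ne_zero]

theorem weyl_mem_unitaryGroup (x : Fin d × Fin d) :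
    weyl d x ∈ Matrix.unitaryGroup (Fin d) ℂ :=
  mul_mem (pow_mem (Matrix.mem_unitaryGroup_iff'.2 conjTranspose_Xd_mul) _)
    (pow_mem (Matrix.mem_unitaryGroup_iff'.2 conjTranspose_Zd_mul) _)

theorem aliceObs_eq (x : Fin d × Fin d) : aliceObs d x = phase d x • weyl d x := rfl

theorem aliceObs_pow_self (x : Fin d × Fin d) : aliceObs d x ^ d = 1 := by
  have h1 : Complex.exp (Real.pi * Complex.I / d) ^ 2 = omega d := by
    rw [← Complex.exp_nat_mul, omega]; congr 1; push_cast; ring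
  rw [aliceObs_eq, smul_pow, weyl, Xd_pow_mul_Zd_pow_pow, mul_comm _ d, mul_comm _ d,
    pow_mul (Xd d), pow_mul (Zd d), Xd_pow_self, Zd_pow_self, one_pow, one_pow, one_mul, smul_smul, phase,
    ← pow_mul, ← h1, ← pow_mul, ← pow_add]
  -- Total exponent of `exp(πi/d)`: the scalar phase contributes the first summand, reordering the
  -- `X` and `Z` factors the second. It is a multiple of `2d`.
  have h2 : (x.1 : ℕ) * x.2 * (d - 1) * d + 2 * (x.1 * x.2 * d.choose 2) =
      2 * (d * (x.1 * x.2 * (d - 1))) := by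
    have h3 : 2 * d.choose 2 = d * (d - 1) := by
      rw [Nat.choose_two_right, Nat.mul_div_cancel' (Nat.even_mul_pred_self d).two_dvd]
    calc _ = (x.1 : ℕ) * x.2 * (d - 1) * d + x.1 * x.2 * (2 * d.choose 2) := by ring
      _ = _ := by rw [h3]; ring
  rw [h2, pow_mul, h1, pow_mul, omega_pow_self, one_pow, one_smul]

theorem aliceObs_mem_unitaryGroup (x : Fin d × Fin d) :
    aliceObs d x ∈ Matrix.unitaryGroup (Fin d) ℂ := by
  rw [Matrix.mem_unitaryGroup_iff', aliceObs_eq, star_smul, Matrix.smul_mul, Matrix.mul_smul,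
    smul_smul, Matrix.mem_unitaryGroup_iff'.1 (weyl_mem_unitaryGroup x), star_phase_mul, one_smul]

theorem aliceMeas_eq (x : Fin d × Fin d) (a : Fin d) :
    aliceMeas d x a = (d : ℂ)⁻¹ • ∑ k : Fin d, (chi a k)⁻¹ • aliceObs d x ^ (k : ℕ) := by
  simp_rw [chi_inv_eq_pow]; rfl

theorem aliceObs_pow_val_neg (x : Fin d × Fin d) (k : Fin d) :
    star (aliceObs d x ^ (k : ℕ)) = aliceObs d x ^ ((-k : Fin d) : ℕ) := by
  have hu := pow_mem (aliceObs_mem_unitaryGroup x) (k : ℕ)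
  have h1 : aliceObs d x ^ (k : ℕ) * aliceObs d x ^ ((-k : Fin d) : ℕ) = 1 := by
    rw [← pow_add]
    have : d ∣ (k : ℕ) + ((-k : Fin d) : ℕ) := by
      have := Fin.val_add k (-k)
      rw [add_neg_cancel] at this
      exact Nat.dvd_of_mod_eq_zero (by simpa using this.symm)
    obtain ⟨m, hm⟩ := this
    rw [hm, pow_mul, aliceObs_pow_self, one_pow]
  calc star (aliceObs d x ^ (k : ℕ))
      = star (aliceObs d x ^ (k : ℕ)) * (aliceObs d x ^ (k : ℕ) *
          aliceObs d x ^ ((-k : Fin d) : ℕ)) := by rw [h1, mul_one]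
    _ = _ := by rw [← mul_assoc, Matrix.mem_unitaryGroup_iff'.1 hu, one_mul]

/-- Since `A` is unitary with `A ^ d = 1`, the adjoint exchanges the summands `k` and `-k`. -/
theorem aliceMeas_isHermitian (x : Fin d × Fin d) (a : Fin d) :
    (aliceMeas d x a).IsHermitian := by
  rw [aliceMeas_eq, Matrix.IsHermitian, ← Matrix.star_eq_conjTranspose, star_smul, star_sum]
  congr 1
  · simp
  · refine Fintype.sum_equiv (Equiv.neg (Fin d)) _ _ fun k => ?_
    rw [star_smul, aliceObs_pow_val_neg, star_inv₀, star_chi, Equiv.neg_apply, chi_neg]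

theorem sum_chi_smul_aliceMeas (x : Fin d × Fin d) (m : Fin d) :
    ∑ a, chi a m • aliceMeas d x a = aliceObs d x ^ (m : ℕ) := by
  simp_rw [aliceMeas_eq, Finset.smul_sum, smul_smul]
  rw [Finset.sum_comm]
  simp_rw [← Finset.sum_smul, mul_left_comm _ (d : ℂ)⁻¹, ← Finset.mul_sum, sum_chi_mul_inv]
  rw [Finset.sum_eq_single m]
  · simp [NeZero.ne d]
  · intro b _ hb; simp [hb.symm]
  · simp

theorem weyl_eq_sum_aliceMeas (hd : 2 ≤ d) (x : Fin d × Fin d) :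
    weyl d x = (phase d x)⁻¹ • ∑ a, chi a 1 • aliceMeas d x a := by
  rw [sum_chi_smul_aliceMeas, Fin.val_one', Nat.mod_eq_of_lt hd, pow_one, aliceObs_eq, smul_smul,
    inv_mul_cancel₀ (phase_ne_zero x), one_smul]

theorem aliceMeas_zero_one (hd : 2 ≤ d) (a : Fin d) :
    aliceMeas d (0, 1) a = Matrix.diagonal (Pi.single a 1) := by
  have h0 : aliceObs d (0, 1) = Zd d := by
    rw [aliceObs_eq, phase, weyl]
    simp [Nat.mod_eq_of_lt hd]
  rw [aliceMeas_eq, h0]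
  ext r c
  simp only [Zd_pow, Matrix.smul_apply, Matrix.sum_apply, Matrix.diagonal_apply, smul_eq_mul]
  split_ifs with h
  · have : ∀ k : Fin d, (chi a k)⁻¹ * omega d ^ ((r : ℕ) * (k : ℕ)) =
        chi k r * (chi k a)⁻¹ := fun k => by
      rw [chi_comm a, chi_comm k r, mul_comm]; rfl
    simp_rw [this, sum_chi_mul_inv, Pi.single_apply]
    split_ifs <;> simp [NeZero.ne d]
  · simp

theorem aliceMeas_one_zero_apply (hd : 2 ≤ d) (a r c : Fin d) :
    aliceMeas d (1, 0) a r c = (d : ℂ)⁻¹ * ((chi a r)⁻¹ * chi a c) := by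
  have h0 : aliceObs d (1, 0) = Xd d := by
    rw [aliceObs_eq, phase, weyl]
    simp [Nat.mod_eq_of_lt hd]
  rw [aliceMeas_eq, h0]
  simp only [Matrix.smul_apply, Matrix.sum_apply, Xd_pow_apply, val_nsmul_one_self, smul_eq_mul]
  rw [Finset.sum_eq_single (r - c)]
  · rw [if_pos (by abel), mul_one, chi_sub, mul_inv, inv_inv]
  · intro k _ hk
    rw [if_neg, mul_zero]
    rintro rfl
    exact hk (by abel)
  · simp

end Weyl

/-! ### Positive semidefinite matrices -/

section PosSemidef

variable {m n : Type*} [Fintype m] [Fintype n]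

theorem trace_mul_nonneg {A B : Matrix n n ℂ} (hA : A.PosSemidef) (hB : B.PosSemidef) :
    0 ≤ (A * B).trace := by
  classical
  open scoped MatrixOrder Matrix.Norms.L2Operator in
  obtain ⟨C, rfl⟩ := CStarAlgebra.nonneg_iff_eq_star_mul_self.mp hB.nonneg
  rw [← Matrix.mul_assoc, Matrix.trace_mul_comm, ← Matrix.mul_assoc, Matrix.star_eq_conjTranspose]
  exact (hA.mul_mul_conjTranspose_same C).trace_nonneg

theorem posSemidef_ketbra (v : n → ℂ) : (ketbra v).PosSemidef :=
  Matrix.posSemidef_vecMulVec_self_star v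

theorem trace_mul_ketbra (A : Matrix n n ℂ) (v : n → ℂ) :
    (A * ketbra v).trace = star v ⬝ᵥ (A *ᵥ v) := by
  rw [ketbra, Matrix.mul_vecMulVec, Matrix.trace_vecMulVec, dotProduct_comm]

theorem PosSemidef.apply_eq_zero {A : Matrix n n ℂ} (hA : A.PosSemidef) {j : n} (hj : A j j = 0)
    (k : n) : A k j = 0 := by
  classical
  have := (hA.dotProduct_mulVec_zero_iff (Pi.single j 1)).1 (by simp [hj])
  simpa using congrFun this k

end PosSemidef

/-! ### Steered operators -/

section Steered

variable {m n : Type*} [Fintype n]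

/-- The operator `Tr_n[ρ (1 ⊗ F)]` on the first factor steered by the effect `F` on the second. -/
def steered (ρ : Matrix (m × n) (m × n) ℂ) (F : Matrix n n ℂ) : Matrix m m ℂ :=
  Matrix.of fun a a' => ∑ f, ∑ f', ρ (a, f) (a', f') * F f' f

theorem steered_add (ρ : Matrix (m × n) (m × n) ℂ) (F G : Matrix n n ℂ) :
    steered ρ (F + G) = steered ρ F + steered ρ G := by
  ext; simp [steered, mul_add, Finset.sum_add_distrib]

theorem steered_sum {o : Type*} [Fintype o] (ρ : Matrix (m × n) (m × n) ℂ)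
    (F : o → Matrix n n ℂ) : steered ρ (∑ b, F b) = ∑ b, steered ρ (F b) := by
  classical
  have h0 : steered ρ 0 = 0 := by ext; simp [steered]
  exact map_sum (AddMonoidHom.mk' (steered ρ) (steered_add ρ)) F Finset.univ

/-- The duality that moves every Born probability to Alice's side. -/
theorem trace_mul_kronecker [Fintype m] (ρ : Matrix (m × n) (m × n) ℂ) (A : Matrix m m ℂ)
    (F : Matrix n n ℂ) : (ρ * (A ⊗ₖ F)).trace = (steered ρ F * A).trace := by
  simp only [Matrix.trace, Matrix.diag_apply, Matrix.mul_apply, Matrix.kronecker_apply, steered,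
    Matrix.of_apply, Fintype.sum_prod_type, Finset.sum_mul]
  refine Finset.sum_congr rfl fun a _ => ?_
  rw [Finset.sum_comm]
  refine Finset.sum_congr rfl fun a' _ => Finset.sum_congr rfl fun f _ =>
    Finset.sum_congr rfl fun f' _ => by ring

theorem posSemidef_steered [Fintype m] {ρ : Matrix (m × n) (m × n) ℂ} (hρ : ρ.PosSemidef)
    {F : Matrix n n ℂ} (hF : F.PosSemidef) : (steered ρ F).PosSemidef := by
  refine Matrix.PosSemidef.of_dotProduct_mulVec_nonneg ?_ fun v => ?_
  · ext a a'
    simp only [Matrix.conjTranspose_apply, steered, Matrix.of_apply, star_sum, star_mul']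
    rw [Finset.sum_comm]
    refine Finset.sum_congr rfl fun f _ => Finset.sum_congr rfl fun f' _ => ?_
    rw [hρ.1.apply, hF.1.apply]
  rw [← trace_mul_ketbra, ← trace_mul_kronecker]
  exact trace_mul_nonneg hρ ((posSemidef_ketbra v).kronecker hF)

theorem steered_one_one_trace [Fintype m] [DecidableEq m] [DecidableEq n]
    (ρ : Matrix (m × n) (m × n) ℂ) : (steered ρ 1).trace = ρ.trace := by
  have := trace_mul_kronecker ρ 1 1
  simpa using this.symm

end Steered

/-! ### Extremal POVMs -/

section Extremal

variable {o n : Type*} [Fintype o] [Fintype n] [DecidableEq n]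

/-- `N` is the midpoint of the POVMs `N + X` and `N - X`. Extremality is used only in this form. -/
theorem IsExtremalPOVM.eq_zero {N X : o → Matrix n n ℂ} (hN : IsExtremalPOVM N)
    (hadd : ∀ b, (N b + X b).PosSemidef) (hsub : ∀ b, (N b - X b).PosSemidef)
    (hX : ∑ b, X b = 0) : X = 0 := by
  have hs := hN.1.2
  have h1 : N + X ∈ povms o n := ⟨hadd, by simp [Finset.sum_add_distrib, hX, hs]⟩
  have h2 : N - X ∈ povms o n := ⟨hsub, by simp [Finset.sum_sub_distrib, hX, hs]⟩
  have := hN.2 h1 h2 ⟨1/2, 1/2, by norm_num, by norm_num, by norm_num, by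
    rw [← smul_add]
    have : N + X + (N - X) = (2 : ℝ) • N := by rw [two_smul]; abel
    rw [this, smul_smul]; norm_num⟩
  simpa using this

/-- A positive semidefinite matrix dominated by a multiple of `|v⟩⟨v|` is a multiple of it. -/
theorem eq_smul_ketbra {A : Matrix n n ℂ} {v : n → ℂ} (hA : A.PosSemidef)
    (hle : (ketbra v - A).PosSemidef) : ∃ c : ℂ, A = c • ketbra v := by
  -- On the orthogonal complement of `v` the form of `A` lies between zero and that of `|v⟩⟨v|`,
  -- which vanishes there.
  have h0 : ∀ w, star v ⬝ᵥ w = 0 → A *ᵥ w = 0 := by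
    intro w hw
    refine (hA.dotProduct_mulVec_zero_iff w).1 (le_antisymm ?_ (hA.dotProduct_mulVec_nonneg w))
    have := hle.dotProduct_mulVec_nonneg w
    rw [Matrix.sub_mulVec, dotProduct_sub, ketbra, Matrix.vecMulVec_mulVec, hw] at this
    simpa using this
  by_cases hv : star v ⬝ᵥ v = 0
  · have : v = 0 := dotProduct_star_self_eq_zero.1 hv
    subst this
    refine ⟨0, ?_⟩
    ext i j
    simpa using congrFun (h0 (Pi.single j 1) (by simp)) i
  have h1 : ∀ i j, A i j = (star v ⬝ᵥ v)⁻¹ * (star v j * (A *ᵥ v) i) := by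
    intro i j
    -- This is a multiple of the component of the `j`-th basis vector orthogonal to `v`; `A` kills
    -- it, so column `j` is a multiple of `A v`. Hermiticity then makes `A v` a multiple of `v`.
    have := congrFun (h0 ((star v ⬝ᵥ v) • Pi.single j 1 - star v j • v) (by
      rw [dotProduct_sub, dotProduct_smul, dotProduct_smul, dotProduct_single_one]
      simp [mul_comm])) i
    rw [Matrix.mulVec_sub, Matrix.mulVec_smul, Matrix.mulVec_smul] at this
    simp only [Pi.sub_apply, Pi.smul_apply, Matrix.mulVec_single_one, Matrix.col_apply,
      smul_eq_mul, Pi.zero_apply, sub_eq_zero] at this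
    rw [← this, inv_mul_cancel_left₀ hv]
  have h2 : ∀ i, (A *ᵥ v) i = (star v ⬝ᵥ v)⁻¹ * (v i * (star (A *ᵥ v) ⬝ᵥ v)) := by
    intro i
    conv_lhs => rw [Matrix.mulVec, dotProduct]
    have h3 : star (star v ⬝ᵥ v) = star v ⬝ᵥ v := by
      rw [← Matrix.star_dotProduct_star, star_star, dotProduct_comm]
    have h4 : ∀ j, A i j = (star v ⬝ᵥ v)⁻¹ * (v i * star ((A *ᵥ v) j)) := fun j => by
      rw [← hA.1.apply, h1, star_mul', star_mul', star_inv₀, h3, Pi.star_apply, star_star]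
    simp_rw [h4, dotProduct, Finset.mul_sum, Pi.star_apply, mul_assoc]
  refine ⟨(star v ⬝ᵥ v)⁻¹ * ((star v ⬝ᵥ v)⁻¹ * (star (A *ᵥ v) ⬝ᵥ v)), ?_⟩
  ext i j
  rw [h1, h2, Matrix.smul_apply, ketbra, Matrix.vecMulVec_apply, smul_eq_mul]
  ring

/-- In a convex decomposition each part is dominated by a rank-one effect, hence proportional to it.
Both families sum to `1`, so independence forces all the factors to be `1`. -/
theorem isExtremalPOVM_of_linearIndependent {v : o → n → ℂ}
    (hsum : ∑ b, ketbra (v b) = 1)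
    (hli : ∀ c : o → ℂ, ∑ b, c b • ketbra (v b) = 0 → c = 0) :
    IsExtremalPOVM fun b => ketbra (v b) := by
  refine ⟨⟨fun b => posSemidef_ketbra _, hsum⟩, ?_⟩
  rintro A ⟨hA, hAs⟩ B ⟨hB, hBs⟩ ⟨s, t, hs, ht, hst, hN⟩
  have hb : ∀ b, ∃ c : ℂ, A b = c • ketbra (v b) := by
    intro b
    have h1 : s • A b + t • B b = ketbra (v b) := congrFun hN b
    obtain ⟨c, hc⟩ := eq_smul_ketbra (A := s • A b) (v := v b) ((hA b).smul hs.le) (by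
      rw [← h1, add_sub_cancel_left]; exact (hB b).smul ht.le)
    refine ⟨(s : ℂ)⁻¹ * c, ?_⟩
    rw [← smul_smul, ← hc]
    ext i j
    have : (s : ℂ) ≠ 0 := by exact_mod_cast hs.ne'
    simp [this]
  choose c hc using hb
  have h2 := hli (fun b => c b - 1) (by
    simp_rw [sub_smul, ← hc, one_smul, Finset.sum_sub_distrib, hAs, hsum, sub_self])
  funext b
  have h3 : c b = 1 := sub_eq_zero.1 (congrFun h2 b)
  rw [hc, h3, one_smul]

end Extremal

/-! ### The steering gap and the rigidity of the steered assemblages -/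

section Gap

variable {d : ℕ}

/-- The trace of `σ` against `diag(∑ i, α_i / α_j) - d |x_a⟩⟨x_a|`, where `|x_a⟩` is the eigenvector
of `X_d` with eigenvalue `ω^a`. -/
def steeringGap (α : Fin d → ℝ) (a : Fin d) (σ : Matrix (Fin d) (Fin d) ℂ) : ℂ :=
  (∑ i, (α i : ℂ)) * ∑ j, σ j j / α j - ∑ j, ∑ k, chi a j * σ j k * (chi a k)⁻¹

theorem steeringGap_add (α : Fin d → ℝ) (a : Fin d) (σ τ : Matrix (Fin d) (Fin d) ℂ) :
    steeringGap α a (σ + τ) = steeringGap α a σ + steeringGap α a τ := by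
  simp only [steeringGap, Matrix.add_apply, add_div, mul_add, add_mul, Finset.sum_add_distrib]
  ring

/-- The vectors whose quadratic forms sum to the steering gap. -/
def gapVec (α : Fin d → ℝ) (a j k : Fin d) : Fin d → ℂ :=
  Pi.single j ((chi a j)⁻¹ / α j) - Pi.single k ((chi a k)⁻¹ / α k)

variable {α : Fin d → ℝ}

theorem star_gapVec (a j k : Fin d) :
    star (gapVec α a j k) = Pi.single j (chi a j / α j) - Pi.single k (chi a k / α k) := by
  rw [gapVec, star_sub, Pi.star_single, Pi.star_single, star_div₀, star_div₀, star_inv₀, star_inv₀,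
    star_chi, star_chi, inv_inv, inv_inv]
  simp

variable [NeZero d]

theorem gapVec_dotProduct (hα : ∀ i, 0 < α i) (a j k : Fin d) (σ : Matrix (Fin d) (Fin d) ℂ) :
    (α j * α k : ℂ) * (star (gapVec α a j k) ⬝ᵥ (σ *ᵥ gapVec α a j k)) =
      (α k * (σ j j / α j) + α j * (σ k k / α k)) -
        (chi a j * σ j k * (chi a k)⁻¹ + chi a k * σ k j * (chi a j)⁻¹) := by
  have h0 : ∀ i, (α i : ℂ) ≠ 0 := fun i => by exact_mod_cast (hα i).ne'
  rw [star_gapVec, gapVec, Matrix.mulVec_sub, sub_dotProduct, dotProduct_sub, dotProduct_sub]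
  simp only [single_dotProduct, Matrix.mulVec_single, Pi.smul_apply, Matrix.col_apply,
    MulOpposite.smul_eq_mul_unop, MulOpposite.unop_op]
  have := h0 j
  have := h0 k
  have := chi_ne_zero a j
  have := chi_ne_zero a k
  field_simp
  ring

/-- Symmetrizing over pairs `(j, k)` completes the square, as for a graph Laplacian with edge
weights `α_j α_k`; this makes the gap visibly nonnegative. -/
theorem steeringGap_eq (hα : ∀ i, 0 < α i) (a : Fin d) (σ : Matrix (Fin d) (Fin d) ℂ) :
    steeringGap α a σ = ∑ j, ∑ k, (α j * α k / 2 : ℂ) *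
      (star (gapVec α a j k) ⬝ᵥ (σ *ᵥ gapVec α a j k)) := by
  have h : ∀ j k, (α j * α k / 2 : ℂ) * (star (gapVec α a j k) ⬝ᵥ (σ *ᵥ gapVec α a j k)) =
      1 / 2 * (α k * (σ j j / α j)) + 1 / 2 * (α j * (σ k k / α k)) -
        (1 / 2 * (chi a j * σ j k * (chi a k)⁻¹) + 1 / 2 * (chi a k * σ k j * (chi a j)⁻¹)) := by
    intro j k
    linear_combination (1 / 2 : ℂ) * gapVec_dotProduct hα a j k σ
  simp_rw [h, Finset.sum_sub_distrib, Finset.sum_add_distrib]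
  have e1 : ∑ j, ∑ k, 1 / 2 * ((α k : ℂ) * (σ j j / α j)) =
      1 / 2 * ((∑ i, (α i : ℂ)) * ∑ j, σ j j / α j) := by
    simp_rw [← Finset.mul_sum, ← Finset.sum_mul, ← Finset.mul_sum]
  have e2 : ∑ j, ∑ k, 1 / 2 * ((α j : ℂ) * (σ k k / α k)) =
      1 / 2 * ((∑ i, (α i : ℂ)) * ∑ j, σ j j / α j) := by
    rw [Finset.sum_comm, e1]
  have e3 : ∑ j, ∑ k, 1 / 2 * (chi a k * σ k j * (chi a j)⁻¹) =
      ∑ j, ∑ k, 1 / 2 * (chi a j * σ j k * (chi a k)⁻¹) := Finset.sum_comm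
  rw [e1, e2, e3, steeringGap]
  simp_rw [← Finset.mul_sum]
  ring

theorem steeringGap_nonneg (hα : ∀ i, 0 < α i) (a : Fin d) {σ : Matrix (Fin d) (Fin d) ℂ}
    (hσ : σ.PosSemidef) : 0 ≤ steeringGap α a σ := by
  rw [steeringGap_eq hα]
  refine Finset.sum_nonneg fun j _ => Finset.sum_nonneg fun k _ =>
    mul_nonneg ?_ (hσ.dotProduct_mulVec_nonneg _)
  have : 0 ≤ α j * α k / 2 := by have := hα j; have := hα k; positivity
  exact_mod_cast this

theorem diag_eq_of_steeringGap_eq_zero (hα : ∀ i, 0 < α i) {a : Fin d}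
    {σ : Matrix (Fin d) (Fin d) ℂ} (hσ : σ.PosSemidef) (h : steeringGap α a σ = 0) (j k : Fin d) :
    σ j j * (α k : ℂ) ^ 2 = σ k k * (α j : ℂ) ^ 2 := by
  have h0 : ∀ i, (α i : ℂ) ≠ 0 := fun i => by exact_mod_cast (hα i).ne'
  have hp : ∀ j k, 0 < (α j * α k / 2 : ℂ) := fun j k => by
    have : 0 < α j * α k / 2 := by have := hα j; have := hα k; positivity
    exact_mod_cast this
  rw [steeringGap_eq hα, Finset.sum_eq_zero_iff_of_nonneg fun j _ => Finset.sum_nonneg fun k _ =>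
    mul_nonneg (hp j k).le (hσ.dotProduct_mulVec_nonneg _)] at h
  have h1 := (Finset.sum_eq_zero_iff_of_nonneg fun k _ =>
    mul_nonneg (hp j k).le (hσ.dotProduct_mulVec_nonneg _)).1 (h j (Finset.mem_univ j)) k
      (Finset.mem_univ k)
  -- With zero gap every square vanishes, so each `gapVec` lies in the kernel of `σ`. Rows `j` and
  -- `k` of that relation both contain the coherence between `j` and `k`; eliminating it leaves the
  -- ratio of the diagonal entries.
  have h2 := (hσ.dotProduct_mulVec_zero_iff _).1 ((mul_eq_zero.1 h1).resolve_left (hp j k).ne')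
  rw [gapVec, Matrix.mulVec_sub] at h2
  have h3 : ∀ i, σ i j * ((chi a j)⁻¹ / α j) = σ i k * ((chi a k)⁻¹ / α k) := fun i => by
    simpa [Matrix.mulVec_single, sub_eq_zero, div_eq_mul_inv] using congrFun h2 i
  have h4 : chi a j / α j * σ j k = chi a k / α k * σ k k := by
    have := congrArg star (h3 k)
    rw [star_mul', star_mul', star_div₀, star_div₀, star_inv₀, star_inv₀, star_chi, star_chi,
      inv_inv, inv_inv, hσ.1.apply, hσ.1.apply] at this
    simpa [mul_comm] using this
  have h5 := h3 j
  have := h0 j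
  have := h0 k
  have := chi_ne_zero a j
  have hk := chi_ne_zero a k
  field_simp at h4 h5
  refine mul_left_cancel₀ hk ?_
  linear_combination h5 * α k + h4 * α j

/-- Assemblages without steering gap have Alice's reduced state of `ψ(α)`, up to normalization. -/
theorem eq_smul_diagonal_of_assemblages (hα : IsSchmidt α)
    {τ₀ τ₁ : Fin d → Matrix (Fin d) (Fin d) ℂ}
    {ρ : Matrix (Fin d) (Fin d) ℂ} (h₀ : ∀ b, (τ₀ b).PosSemidef) (h₁ : ∀ b, (τ₁ b).PosSemidef)
    (hs₀ : ∑ b, τ₀ b = ρ) (hs₁ : ∑ b, τ₁ b = ρ) (hz : ∀ b j, j ≠ -b → τ₀ b j j = 0)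
    (hg : ∀ b, steeringGap α (-b) (τ₁ b) = 0) :
    ρ = ρ.trace • Matrix.diagonal fun i => (α i : ℂ) ^ 2 := by
  have hsum : ∑ i, (α i : ℂ) ^ 2 = 1 := by exact_mod_cast hα.2
  ext j k
  rw [Matrix.smul_apply, Matrix.diagonal_apply, smul_eq_mul]
  split_ifs with hjk
  · subst hjk
    have h2 : ∀ k, ρ j j * (α k : ℂ) ^ 2 = ρ k k * (α j : ℂ) ^ 2 := fun k => by
      rw [← hs₁, Matrix.sum_apply, Matrix.sum_apply, Finset.sum_mul, Finset.sum_mul]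
      exact Finset.sum_congr rfl fun b _ => diag_eq_of_steeringGap_eq_zero hα.1 (h₁ b) (hg b) j k
    calc ρ j j = ∑ k, ρ j j * (α k : ℂ) ^ 2 := by rw [← Finset.mul_sum, hsum, mul_one]
      _ = _ := by simp_rw [h2, ← Finset.sum_mul]; rfl
  · rw [mul_zero, ← hs₀, Matrix.sum_apply]
    refine Finset.sum_eq_zero fun b _ => ?_
    by_cases hk : k = -b
    · have hj : j ≠ -b := fun h => hjk (h.trans hk.symm)
      rw [← (h₀ b).1.apply, PosSemidef.apply_eq_zero (h₀ b) (hz b j hj), star_zero]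
    · exact PosSemidef.apply_eq_zero (h₀ b) (hz b k hk) j

end Gap

/-! ### The steering functional of an assemblage -/

section Functional

variable {d : ℕ} {α : Fin d → ℝ}

theorem sum_Ico_one (hd : 2 ≤ d) (f : ℕ → ℂ) :
    ∑ k ∈ Finset.Ico 1 d, f k = ∑ k : Fin d, f k - f 0 := by
  rw [Fin.sum_univ_eq_sum_range, Finset.sum_range_eq_add_Ico _ (by omega), add_sub_cancel_left]

theorem sum_offDiag_ratio (hα : ∀ i, 0 < α i) (g : Fin d → ℂ) :
    ∑ ij ∈ (Finset.univ : Finset (Fin d)).offDiag, ((α ij.1 / α ij.2 : ℝ) : ℂ) * g ij.2 =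
      (∑ i, (α i : ℂ)) * ∑ j, g j / α j - ∑ j, g j := by
  have h0 : ∀ i, (α i : ℂ) ≠ 0 := fun i => by exact_mod_cast (hα i).ne'
  have h1 : (Finset.univ : Finset (Fin d)).offDiag = Finset.univ.filter fun ij => ij.1 ≠ ij.2 := by
    ext; simp
  rw [h1, Finset.sum_filter, Fintype.sum_prod_type_right, Finset.mul_sum, ← Finset.sum_sub_distrib]
  refine Finset.sum_congr rfl fun j _ => ?_
  rw [← Finset.sum_filter, Finset.filter_ne', Finset.sum_erase_eq_sub (Finset.mem_univ j)]
  push_cast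
  rw [div_self (h0 j), one_mul, Finset.sum_mul]
  congr 1
  exact Finset.sum_congr rfl fun i _ => by ring

theorem offDiag_ratio_pos (hd : 2 ≤ d) (hα : ∀ i, 0 < α i) :
    0 < ∑ ij ∈ (Finset.univ : Finset (Fin d)).offDiag, α ij.1 / α ij.2 := by
  refine Finset.sum_pos (fun ij _ => div_pos (hα _) (hα _))
    ⟨(⟨0, by omega⟩, ⟨1, by omega⟩), by simp⟩

theorem gammaCoeff_pos (hd : 2 ≤ d) (hα : ∀ i, 0 < α i) : 0 < gammaCoeff α :=
  div_pos (by exact_mod_cast (by omega : 0 < d)) (offDiag_ratio_pos hd hα)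

/-- This normalization fixes `γ`: the missing `k = 0` term of the functional would be `1 + γ - 1 =
γ`, which cancels the constant produced by the full sum of the `δ` terms. -/
theorem deltaCoeff_zero (hd : 2 ≤ d) (hα : ∀ i, 0 < α i) : deltaCoeff α 0 = -1 := by
  have h := offDiag_ratio_pos hd hα
  have hd' : (d : ℂ) ≠ 0 := by exact_mod_cast (by omega : d ≠ 0)
  simp only [deltaCoeff, gammaCoeff, zero_mul, pow_zero, mul_one, ← Complex.ofReal_sum]
  have h' := Complex.ofReal_ne_zero.2 h.ne'
  push_cast at h' ⊢
  field_simp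

variable [NeZero d]

theorem deltaCoeff_val (hα : ∀ i, 0 < α i) (k : Fin d) :
    deltaCoeff α k = -((gammaCoeff α : ℂ) / d) *
      ((∑ i, (α i : ℂ)) * ∑ j, (chi k j)⁻¹ / α j - ∑ j, (chi k j)⁻¹) := by
  rw [deltaCoeff, ← sum_offDiag_ratio hα]
  congr 1
  refine Finset.sum_congr rfl fun ij _ => ?_
  congr 1
  refine eq_inv_of_mul_eq_one_left ?_
  rw [chi, ← pow_add, ← mul_add, Nat.sub_add_cancel ij.2.2.le, mul_comm, pow_mul, omega_pow_self,
    one_pow]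

/-- By Fourier inversion the `δ` terms form an operator diagonal in the `Z` basis, with this
eigenvalue at `|a⟩`. It supplies the diagonal part of the Laplacian in `steeringGap`. -/
theorem sum_deltaCoeff_mul_chi (hα : ∀ i, 0 < α i) (a : Fin d) :
    ∑ k : Fin d, deltaCoeff α k * chi k a =
      -(gammaCoeff α : ℂ) * ((∑ i, (α i : ℂ)) / α a - 1) := by
  have hd' : (d : ℂ) ≠ 0 := by exact_mod_cast NeZero.ne d
  have h1 : ∀ k : Fin d, deltaCoeff α k * chi k a = -((gammaCoeff α : ℂ) / d) *
      ((∑ i, (α i : ℂ)) * (∑ j, chi k a * (chi k j)⁻¹ / α j) - ∑ j, chi k a * (chi k j)⁻¹) := by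
    intro k
    have e1 : (∑ j, (chi k j)⁻¹ / (α j : ℂ)) * chi k a = ∑ j, chi k a * (chi k j)⁻¹ / α j := by
      rw [Finset.sum_mul]
      exact Finset.sum_congr rfl fun j _ => by ring
    have e2 : (∑ j, (chi k j)⁻¹) * chi k a = ∑ j, chi k a * (chi k j)⁻¹ := by
      rw [Finset.sum_mul]
      exact Finset.sum_congr rfl fun j _ => by ring
    rw [deltaCoeff_val hα, ← e1, ← e2]
    ring
  have s1 : ∑ k, ∑ j, chi k a * (chi k j)⁻¹ / (α j : ℂ) = d / α a := by
    rw [Finset.sum_comm]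
    simp_rw [← Finset.sum_div, sum_chi_mul_inv, ite_div, zero_div]
    simp
  have s2 : ∑ k, ∑ j, chi k a * (chi k j)⁻¹ = (d : ℂ) := by
    rw [Finset.sum_comm]
    simp_rw [sum_chi_mul_inv]
    simp
  rw [Finset.sum_congr rfl fun k _ => h1 k, ← Finset.mul_sum, Finset.sum_sub_distrib,
    ← Finset.mul_sum, s1, s2]
  field_simp

/-- Orthogonality of characters keeps only outcomes with `a + b = 0`; hence the index `-b`
throughout. -/
theorem sum_gexp_diag (P : Fin d → Fin d → ℂ) :
    ∑ k : Fin d, ∑ a : Fin d, ∑ b : Fin d,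
        omega d ^ ((a : ℕ) * (k : ℕ) + (b : ℕ) * (k : ℕ)) * P a b = d * ∑ b, P (-b) b := by
  have h : ∀ k a b : Fin d, omega d ^ ((a : ℕ) * (k : ℕ) + (b : ℕ) * (k : ℕ)) = chi k (a + b) := by
    intro k a b
    rw [chi_add, chi_comm, chi_comm k, chi, chi, pow_add]
  calc _ = ∑ a : Fin d, ∑ b : Fin d, (∑ k : Fin d, chi k (a + b)) * P a b := by
        simp_rw [h]
        rw [Finset.sum_comm]
        refine Finset.sum_congr rfl fun a _ => ?_
        rw [Finset.sum_comm]
        simp_rw [Finset.sum_mul]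
    _ = _ := by
        simp_rw [sum_chi, add_eq_zero_iff_eq_neg]
        rw [Finset.sum_comm, Finset.mul_sum]
        simp

theorem sum_deltaCoeff_mul_gexp (hα : ∀ i, 0 < α i) (P : Fin d → Fin d → ℂ) :
    ∑ k : Fin d, deltaCoeff α k * ∑ a : Fin d, ∑ b : Fin d,
        omega d ^ ((a : ℕ) * (k : ℕ) + (b : ℕ) * 0) * P a b =
      -(gammaCoeff α : ℂ) * ((∑ i, (α i : ℂ)) * (∑ a, (∑ b, P a b) / α a) - ∑ a, ∑ b, P a b) := by
  have h : ∀ k : Fin d, deltaCoeff α k * ∑ a : Fin d, ∑ b : Fin d,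
      omega d ^ ((a : ℕ) * (k : ℕ) + (b : ℕ) * 0) * P a b =
      ∑ a, (deltaCoeff α k * chi k a) * ∑ b, P a b := by
    intro k
    rw [Finset.mul_sum]
    refine Finset.sum_congr rfl fun a _ => ?_
    simp_rw [mul_zero, add_zero, ← Finset.mul_sum, mul_assoc]
    rw [chi_comm, chi]
  simp_rw [h]
  rw [Finset.sum_comm]
  simp_rw [← Finset.sum_mul, sum_deltaCoeff_mul_chi hα, mul_assoc, ← Finset.mul_sum, sub_mul,
    one_mul, Finset.sum_sub_distrib, Finset.mul_sum (s := Finset.univ) (a := ∑ i, (α i : ℂ)),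
    div_mul_eq_mul_div, mul_div_assoc]

theorem sum_steering_terms (hd : 2 ≤ d) (hα : ∀ i, 0 < α i) (P₀ P₁ : Fin d → Fin d → ℂ)
    (h₀ : ∑ a, ∑ b, P₀ a b = 1) (h₁ : ∑ a, ∑ b, P₁ a b = 1) :
    ∑ k ∈ Finset.Ico 1 d,
      (∑ a : Fin d, ∑ b : Fin d, omega d ^ ((a : ℕ) * k + (b : ℕ) * k) * P₀ a b +
        (gammaCoeff α : ℂ) *
          ∑ a : Fin d, ∑ b : Fin d, omega d ^ ((a : ℕ) * k + (b : ℕ) * k) * P₁ a b +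
        deltaCoeff α k *
          ∑ a : Fin d, ∑ b : Fin d, omega d ^ ((a : ℕ) * k + (b : ℕ) * 0) * P₀ a b) =
      d * ∑ b, P₀ (-b) b + (gammaCoeff α : ℂ) * (d * ∑ b, P₁ (-b) b -
        (∑ i, (α i : ℂ)) * ∑ a, (∑ b, P₀ a b) / α a) := by
  rw [sum_Ico_one hd]
  simp_rw [Finset.sum_add_distrib, ← Finset.mul_sum, sum_gexp_diag, sum_deltaCoeff_mul_gexp hα]
  rw [deltaCoeff_zero hd hα]
  simp only [mul_zero, add_zero, pow_zero, one_mul, h₀, h₁]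
  ring

/-- The deficit of the steering functional is the weighted total gap of the two assemblages. -/
theorem sub_steeringValue_eq (hd : 2 ≤ d) (hα : ∀ i, 0 < α i) {ι : Type} (p : Correlations d ι)
    {τ₀ τ₁ : Fin d → Matrix (Fin d) (Fin d) ℂ} {ρ : Matrix (Fin d) (Fin d) ℂ}
    (hs₀ : ∑ b, τ₀ b = ρ) (hs₁ : ∑ b, τ₁ b = ρ) (hρ : ρ.trace = 1)
    (hp₀ : ∀ a b, (p.first (0, 1) 0 a b : ℂ) = (τ₀ b * aliceMeas d (0, 1) a).trace)
    (hp₁ : ∀ a b, (p.first (1, 0) 1 a b : ℂ) = (τ₁ b * aliceMeas d (1, 0) a).trace) :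
    d - steeringValue α p =
      (d * ∑ b, ((τ₀ b).trace - τ₀ b (-b) (-b)) +
        (gammaCoeff α : ℂ) * ∑ b, steeringGap α (-b) (τ₁ b)).re := by
  have q₀ : ∀ a b, (p.first (0, 1) 0 a b : ℂ) = τ₀ b a a := fun a b => by
    rw [hp₀, aliceMeas_zero_one hd, Matrix.trace]
    simp [Matrix.mul_diagonal, Pi.single_apply]
  have q₁ : ∀ a b, d * (p.first (1, 0) 1 a b : ℂ) =
      ∑ j, ∑ k, chi a j * τ₁ b j k * (chi a k)⁻¹ := fun a b => by
    have hd' : (d : ℂ) ≠ 0 := by exact_mod_cast NeZero.ne d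
    rw [hp₁, Matrix.trace, Finset.mul_sum]
    refine Finset.sum_congr rfl fun j _ => ?_
    rw [Matrix.diag_apply, Matrix.mul_apply, Finset.mul_sum]
    refine Finset.sum_congr rfl fun k _ => ?_
    rw [aliceMeas_one_zero_apply hd]
    field_simp
  have t₀ : ∀ a, ∑ b, (p.first (0, 1) 0 a b : ℂ) = ρ a a := fun a => by
    simp_rw [q₀, ← hs₀, Matrix.sum_apply]
  have m₁ : ∑ a, ∑ b, (p.first (1, 0) 1 a b : ℂ) = 1 := by
    have h : ∑ a : Fin d, aliceMeas d (1, 0) a = 1 := by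
      have := sum_chi_smul_aliceMeas (d := d) (1, 0) 0
      simpa using this
    rw [Finset.sum_comm]
    simp_rw [hp₁, ← Matrix.trace_sum, ← Matrix.mul_sum, h, mul_one, hs₁, hρ]
  have m₀ : ∑ a, ∑ b, (p.first (0, 1) 0 a b : ℂ) = 1 := by simp_rw [t₀]; exact hρ
  have key := sum_steering_terms hd hα (fun a b => (p.first (0, 1) 0 a b : ℂ))
    (fun a b => (p.first (1, 0) 1 a b : ℂ)) m₀ m₁
  have hv : steeringValue α p = (d * ∑ b, (p.first (0, 1) 0 (-b) b : ℂ) + (gammaCoeff α : ℂ) *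
      (d * ∑ b, (p.first (1, 0) 1 (-b) b : ℂ) - (∑ i, (α i : ℂ)) * ∑ a, ρ a a / α a)).re := by
    simp_rw [t₀] at key
    rw [← key]
    rfl
  have hg : ∑ b, steeringGap α (-b) (τ₁ b) = (∑ i, (α i : ℂ)) * ∑ a, ρ a a / α a -
      d * ∑ b, (p.first (1, 0) 1 (-b) b : ℂ) := by
    simp_rw [steeringGap, Finset.sum_sub_distrib, ← q₁, ← Finset.mul_sum]
    rw [Finset.sum_comm]
    simp_rw [← Finset.sum_div, ← hs₁, Matrix.sum_apply]
  have ht : ∑ b, ((τ₀ b).trace - τ₀ b (-b) (-b)) = 1 - ∑ b, (p.first (0, 1) 0 (-b) b : ℂ) := by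
    simp_rw [q₀, Finset.sum_sub_distrib, ← Matrix.trace_sum, hs₀, hρ]
  rw [hg, ht, hv]
  rw [← Complex.natCast_re, ← Complex.sub_re]
  congr 1
  ring

end Functional

/-! ### Measurements -/

section Povm

theorem PosSemidef.one_sub_of_mem_povms {o n : Type*} [Fintype o] [Fintype n] [DecidableEq n]
    {N : o → Matrix n n ℂ} (hN : N ∈ povms o n) (b : o) : (1 - N b).PosSemidef := by
  classical
  rw [← hN.2, ← Finset.sum_erase_add _ _ (Finset.mem_univ b), add_sub_cancel_right]
  exact Matrix.posSemidef_sum _ fun i _ => hN.1 i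

theorem ofReal_re_trace_mul {n : Type*} [Fintype n] {A B : Matrix n n ℂ} (hA : A.IsHermitian)
    (hB : B.IsHermitian) : (((A * B).trace.re : ℝ) : ℂ) = (A * B).trace := by
  refine Complex.conj_eq_iff_re.1 ?_
  rw [starRingEnd_apply, ← Matrix.trace_conjTranspose, Matrix.conjTranspose_mul, hA, hB,
    Matrix.trace_mul_comm]

theorem sum_kronecker {o m n : Type*} [Fintype o] (N : o → Matrix m m ℂ) (E : Matrix n n ℂ) :
    ∑ b, N b ⊗ₖ E = (∑ b, N b) ⊗ₖ E := by
  ext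
  simp [Matrix.sum_apply, Finset.sum_mul]

theorem trace_sub_apply {n : Type*} [Fintype n] [DecidableEq n] (σ : Matrix n n ℂ) (c : n) :
    σ.trace - σ c c = ∑ j ∈ Finset.univ.erase c, σ j j :=
  (Finset.sum_erase_eq_sub (f := fun j => σ j j) (Finset.mem_univ c)).symm

theorem trace_sub_diag_nonneg {n : Type*} [Fintype n] [DecidableEq n] {σ : Matrix n n ℂ}
    (hσ : σ.PosSemidef) (c : n) : 0 ≤ σ.trace - σ c c := by
  rw [trace_sub_apply]
  exact Finset.sum_nonneg fun j _ => hσ.diag_nonneg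

theorem apply_eq_zero_of_trace_sub_diag {n : Type*} [Fintype n] [DecidableEq n] {σ : Matrix n n ℂ}
    (hσ : σ.PosSemidef) {c : n} (h : σ.trace - σ c c = 0) (j : n) (hj : j ≠ c) : σ j j = 0 := by
  rw [trace_sub_apply, Finset.sum_eq_zero_iff_of_nonneg fun j _ => hσ.diag_nonneg] at h
  exact h j (by simp [hj])

end Povm

/-! ### The assemblages steered by a realization -/

namespace Realization

variable {d : ℕ} {ι : Type} [Fintype ι] (Q : Realization d ι)

theorem tr_eq (A : Matrix (Fin d) (Fin d) ℂ) (B : Matrix (Fin Q.dimB) (Fin Q.dimB) ℂ)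
    (E : Matrix (Fin Q.dimE) (Fin Q.dimE) ℂ) :
    Q.tr A B E = (steered Q.ρ (B ⊗ₖ E) * A).trace := trace_mul_kronecker _ _ _

theorem guess_eq (E : ι → Matrix (Fin Q.dimE) (Fin Q.dimE) ℂ) :
    Q.guess E = ∑ b, (steered Q.ρ (Q.R b ⊗ₖ E b)).trace.re := by
  simp_rw [guess, tr_eq, mul_one]

variable {Q}

theorem posSemidef_steered {B : Matrix (Fin Q.dimB) (Fin Q.dimB) ℂ}
    {E : Matrix (Fin Q.dimE) (Fin Q.dimE) ℂ} (hB : B.PosSemidef) (hE : E.PosSemidef) :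
    (steered Q.ρ (B ⊗ₖ E)).PosSemidef :=
  Steering.posSemidef_steered Q.isDensity.1 (hB.kronecker hE)

theorem sum_steered {o : Type*} [Fintype o] {N : o → Matrix (Fin Q.dimB) (Fin Q.dimB) ℂ}
    (hN : N ∈ povms o (Fin Q.dimB)) (E : Matrix (Fin Q.dimE) (Fin Q.dimE) ℂ) :
    ∑ b, steered Q.ρ (N b ⊗ₖ E) = steered Q.ρ (1 ⊗ₖ E) := by
  rw [← steered_sum, sum_kronecker, hN.2]

theorem steered_add_compl (B : Matrix (Fin Q.dimB) (Fin Q.dimB) ℂ)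
    (E : Matrix (Fin Q.dimE) (Fin Q.dimE) ℂ) :
    steered Q.ρ (B ⊗ₖ E) + steered Q.ρ (B ⊗ₖ (1 - E)) = steered Q.ρ (B ⊗ₖ 1) := by
  rw [← steered_add, ← Matrix.kronecker_add, add_sub_cancel]

theorem trace_steered_one : (steered Q.ρ ((1 : Matrix (Fin Q.dimB) (Fin Q.dimB) ℂ) ⊗ₖ
    (1 : Matrix (Fin Q.dimE) (Fin Q.dimE) ℂ))).trace = 1 := by
  rw [Matrix.one_kronecker_one, steered_one_one_trace, Q.isDensity.2]

variable [NeZero d]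

theorem ofReal_corr_first (x : Fin d × Fin d) (y : Fin 2) (a b : Fin d) :
    (Q.corr.first x y a b : ℂ) = (steered Q.ρ (Q.N y b ⊗ₖ 1) * aliceMeas d x a).trace := by
  rw [← ofReal_re_trace_mul (posSemidef_steered ((Q.N_mem y).1 b) .one).1
    (aliceMeas_isHermitian x a), ← tr_eq]
  rfl

theorem ofReal_corr_third (x : Fin d × Fin d) (a : Fin d) (b : ι) :
    (Q.corr.third x a b : ℂ) = (steered Q.ρ (Q.R b ⊗ₖ 1) * aliceMeas d x a).trace := by
  rw [← ofReal_re_trace_mul (posSemidef_steered (Q.R_mem.1 b) .one).1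
    (aliceMeas_isHermitian x a), ← tr_eq]
  rfl

/-- The tomographic data are functions of the correlations, so the certification conditions depend
on `p` alone. -/
theorem tr_weyl_eq (hd : 2 ≤ d) (x : Fin d × Fin d) (b : ι) :
    Q.tr (weyl d x) (Q.R b) 1 = (phase d x)⁻¹ * ∑ a, chi a 1 * (Q.corr.third x a b : ℂ) := by
  simp_rw [tr_eq, weyl_eq_sum_aliceMeas hd x, ofReal_corr_third, Matrix.mul_smul, Matrix.mul_sum,
    Matrix.mul_smul, Matrix.trace_smul, Matrix.trace_sum, Matrix.trace_smul, smul_eq_mul]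

variable {α : Fin d → ℝ}

theorem sub_steeringValue_corr_eq (hd : 2 ≤ d) (hα : ∀ i, 0 < α i) :
    d - steeringValue α Q.corr =
      (d * ∑ b, ((steered Q.ρ (Q.N 0 b ⊗ₖ 1)).trace - steered Q.ρ (Q.N 0 b ⊗ₖ 1) (-b) (-b)) +
        (gammaCoeff α : ℂ) *
          ∑ b, steeringGap α (-b) (steered Q.ρ (Q.N 1 b ⊗ₖ 1))).re :=
  sub_steeringValue_eq hd hα Q.corr (sum_steered (Q.N_mem 0) 1) (sum_steered (Q.N_mem 1) 1)
    trace_steered_one (fun a b => ofReal_corr_first _ _ a b) fun a b => ofReal_corr_first _ _ a b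

theorem steeringDeficit_nonneg (hα : ∀ i, 0 < α i) :
    0 ≤ ∑ b, ((steered Q.ρ (Q.N 0 b ⊗ₖ 1)).trace - steered Q.ρ (Q.N 0 b ⊗ₖ 1) (-b) (-b)) ∧
    0 ≤ ∑ b, steeringGap α (-b) (steered Q.ρ (Q.N 1 b ⊗ₖ 1)) :=
  ⟨Finset.sum_nonneg fun b _ =>
    trace_sub_diag_nonneg (posSemidef_steered ((Q.N_mem 0).1 b) .one) _,
  Finset.sum_nonneg fun b _ =>
    steeringGap_nonneg hα _ (posSemidef_steered ((Q.N_mem 1).1 b) .one)⟩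

theorem steeringValue_le (hd : 2 ≤ d) (hα : ∀ i, 0 < α i) : steeringValue α Q.corr ≤ d := by
  rw [← sub_nonneg, sub_steeringValue_corr_eq hd hα]
  have hγ : (0 : ℂ) ≤ gammaCoeff α := by exact_mod_cast (gammaCoeff_pos hd hα).le
  have h := steeringDeficit_nonneg (Q := Q) hα
  exact (Complex.nonneg_iff.1 (add_nonneg (mul_nonneg (by positivity) h.1) (mul_nonneg hγ h.2))).1

/-- A realization that attains the value `d` of the steering functional steers, with any effect of
Eve, a multiple of Alice's reduced state of `ψ(α)`. -/
theorem steered_one_eq (hd : 2 ≤ d) (hα : IsSchmidt α) (hQ : (d : ℝ) ≤ steeringValue α Q.corr)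
    {E : Matrix (Fin Q.dimE) (Fin Q.dimE) ℂ} (hE : E.PosSemidef) (hE' : (1 - E).PosSemidef) :
    steered Q.ρ (1 ⊗ₖ E) =
      (steered Q.ρ (1 ⊗ₖ E)).trace • Matrix.diagonal fun i => (α i : ℂ) ^ 2 := by
  have hγ : (0 : ℂ) < gammaCoeff α := by exact_mod_cast gammaCoeff_pos hd hα.1
  have hd' : (0 : ℂ) < d := by exact_mod_cast (by omega : 0 < d)
  obtain ⟨n₀, n₁⟩ := steeringDeficit_nonneg (Q := Q) hα.1
  have h0 : d * ∑ b, ((steered Q.ρ (Q.N 0 b ⊗ₖ 1)).trace -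
      steered Q.ρ (Q.N 0 b ⊗ₖ 1) (-b) (-b)) + (gammaCoeff α : ℂ) *
      ∑ b, steeringGap α (-b) (steered Q.ρ (Q.N 1 b ⊗ₖ 1)) = 0 := by
    have hn := add_nonneg (mul_nonneg hd'.le n₀) (mul_nonneg hγ.le n₁)
    -- The deficit is a nonnegative complex number, hence real, and `hQ` makes its real part
    -- nonpositive.
    refine Complex.ext ?_ (Complex.nonneg_iff.1 hn).2.symm
    refine le_antisymm ?_ (Complex.nonneg_iff.1 hn).1
    rw [← sub_steeringValue_corr_eq hd hα.1]
    simpa using hQ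
  rw [add_eq_zero_iff_of_nonneg (mul_nonneg hd'.le n₀) (mul_nonneg hγ.le n₁),
    mul_eq_zero_iff_left hd'.ne', mul_eq_zero_iff_left hγ.ne',
    Finset.sum_eq_zero_iff_of_nonneg fun b _ =>
      trace_sub_diag_nonneg (posSemidef_steered ((Q.N_mem 0).1 b) .one) _,
    Finset.sum_eq_zero_iff_of_nonneg fun b _ =>
      steeringGap_nonneg hα.1 _ (posSemidef_steered ((Q.N_mem 1).1 b) .one)] at h0
  have p := fun y b => posSemidef_steered (Q := Q) ((Q.N_mem y).1 b) hE
  have p' := fun y b => posSemidef_steered (Q := Q) ((Q.N_mem y).1 b) hE'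
  refine eq_smul_diagonal_of_assemblages hα (p 0) (p 1) (sum_steered (Q.N_mem 0) E)
    (sum_steered (Q.N_mem 1) E) (fun b j hj => ?_) fun b => ?_
  · have h := apply_eq_zero_of_trace_sub_diag (posSemidef_steered ((Q.N_mem 0).1 b) .one)
      (h0.1 b (Finset.mem_univ b)) j hj
    -- Two nonnegative contributions, from `E` and from `1 - E`, add up to zero, so the one from `E`
    -- vanishes.
    rw [← steered_add_compl _ E, Matrix.add_apply,
      add_eq_zero_iff_of_nonneg (p 0 b).diag_nonneg (p' 0 b).diag_nonneg] at h
    exact h.1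
  · have h := h0.2 b (Finset.mem_univ b)
    rw [← steered_add_compl _ E, steeringGap_add, add_eq_zero_iff_of_nonneg
      (steeringGap_nonneg hα.1 _ (p 1 b)) (steeringGap_nonneg hα.1 _ (p' 1 b))] at h
    exact h.1

end Realization

/-! ### Assemblages of the reference state -/

section Reference

variable {d : ℕ} {α : Fin d → ℝ}

/-- The operator `diag(α) Mᵀ diag(α)`, which the effect `M` steers from `ψ(α)`. -/
def twist (α : Fin d → ℝ) (M : Matrix (Fin d) (Fin d) ℂ) : Matrix (Fin d) (Fin d) ℂ :=
  Matrix.of fun j k => α j * M k j * α k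

/-- The inverse of `twist`. -/
def untwist (α : Fin d → ℝ) (M : Matrix (Fin d) (Fin d) ℂ) : Matrix (Fin d) (Fin d) ℂ :=
  Matrix.of fun j k => (α j : ℂ)⁻¹ * M k j * (α k : ℂ)⁻¹

theorem untwist_twist (hα : ∀ i, 0 < α i) (M : Matrix (Fin d) (Fin d) ℂ) :
    untwist α (twist α M) = M := by
  have h0 : ∀ i, (α i : ℂ) ≠ 0 := fun i => by exact_mod_cast (hα i).ne'
  ext j k
  have := h0 j
  have := h0 k
  simp only [untwist, twist, Matrix.of_apply]
  field_simp

theorem twist_untwist (hα : ∀ i, 0 < α i) (M : Matrix (Fin d) (Fin d) ℂ) :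
    twist α (untwist α M) = M := by
  have h0 : ∀ i, (α i : ℂ) ≠ 0 := fun i => by exact_mod_cast (hα i).ne'
  ext j k
  have := h0 j
  have := h0 k
  simp only [untwist, twist, Matrix.of_apply]
  field_simp

theorem untwist_add (M N : Matrix (Fin d) (Fin d) ℂ) :
    untwist α (M + N) = untwist α M + untwist α N := by
  ext; simp [untwist, mul_add, add_mul]

theorem untwist_sub (M N : Matrix (Fin d) (Fin d) ℂ) :
    untwist α (M - N) = untwist α M - untwist α N := by
  ext; simp [untwist, mul_sub, sub_mul]

theorem untwist_sum {o : Type*} [Fintype o] (M : o → Matrix (Fin d) (Fin d) ℂ) :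
    untwist α (∑ b, M b) = ∑ b, untwist α (M b) :=
  map_sum (AddMonoidHom.mk' (untwist α) untwist_add) M Finset.univ

theorem twist_sum {o : Type*} [Fintype o] (M : o → Matrix (Fin d) (Fin d) ℂ) :
    twist α (∑ b, M b) = ∑ b, twist α (M b) := by
  ext; simp [twist, Matrix.sum_apply, Finset.mul_sum, Finset.sum_mul]

theorem twist_one : twist α 1 = Matrix.diagonal fun i => (α i : ℂ) ^ 2 := by
  ext j k
  rw [twist, Matrix.of_apply, Matrix.one_apply, Matrix.diagonal_apply]
  by_cases h : j = k
  · subst h; simp [sq]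
  · simp [h, Ne.symm h]

/-- `untwist` is a transpose followed by congruence with `diag(α)⁻¹`. -/
theorem posSemidef_untwist {M : Matrix (Fin d) (Fin d) ℂ} (hM : M.PosSemidef) :
    (untwist α M).PosSemidef := by
  have h := hM.transpose.mul_mul_conjTranspose_same (Matrix.diagonal fun i => (α i : ℂ)⁻¹)
  have h1 : untwist α M = Matrix.diagonal (fun i => (α i : ℂ)⁻¹) * Mᵀ *
      (Matrix.diagonal fun i => (α i : ℂ)⁻¹)ᴴ := by
    ext j k
    simp [untwist, Matrix.diagonal_conjTranspose, Matrix.mul_diagonal, Matrix.diagonal_mul]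
  rw [h1]
  exact h

theorem steered_ketbra_psi (M : Matrix (Fin d) (Fin d) ℂ) :
    steered (ketbra (psi α)) M = twist α M := by
  ext j k
  simp [steered, twist, ketbra, psi, Matrix.vecMulVec_apply, apply_ite star, mul_right_comm]

theorem expect_psi (A M : Matrix (Fin d) (Fin d) ℂ) :
    expect (A ⊗ₖ M) (psi α) = (twist α M * A).trace := by
  rw [expect, ← trace_mul_ketbra, Matrix.trace_mul_comm, trace_mul_kronecker, steered_ketbra_psi]

theorem rhoB_eq : rhoB α = Matrix.diagonal fun i => (α i : ℂ) ^ 2 := by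
  ext j k
  rw [Matrix.diagonal_apply]
  simp only [rhoB, traceFirst, ketbra, psi, Matrix.vecMulVec_apply, Pi.star_apply, apply_ite star,
    star_zero]
  by_cases h : j = k
  · subst h; simp [sq]
  · rw [if_neg h]
    refine Finset.sum_eq_zero fun a _ => ?_
    by_cases ha : a = j
    · subst ha; simp [h]
    · simp [ha]

theorem trace_mul_rhoB (M : Matrix (Fin d) (Fin d) ℂ) :
    (M * rhoB α).trace = (twist α M).trace := by
  rw [rhoB_eq, Matrix.trace, Matrix.trace]
  refine Finset.sum_congr rfl fun i _ => ?_
  simp only [Matrix.diag_apply, Matrix.mul_diagonal, twist, Matrix.of_apply]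
  ring

theorem isDensity_ketbra_psi (hα : IsSchmidt α) : IsDensity (ketbra (psi α)) := by
  refine ⟨posSemidef_ketbra _, ?_⟩
  rw [← steered_one_one_trace, steered_ketbra_psi, twist_one, Matrix.trace_diagonal]
  exact_mod_cast hα.2

end Reference

/-! ### Adding and removing Eve's system -/

section Eve

variable {d : ℕ} {ι : Type} [Fintype ι]

theorem trace_submatrix_equiv {m n : Type*} [Fintype m] [Fintype n] (M : Matrix n n ℂ)
    (e : m ≃ n) : (M.submatrix e e).trace = M.trace :=
  e.sum_comp fun i => M i i

/-- The product state `ρ ⊗ σ` on Alice, Bob and Eve. -/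
def attachEve {a b e : Type*} (ρ : Matrix (a × b) (a × b) ℂ) (σ : Matrix e e ℂ) :
    Matrix (a × (b × e)) (a × (b × e)) ℂ :=
  (ρ ⊗ₖ σ).submatrix (Equiv.prodAssoc a b e).symm (Equiv.prodAssoc a b e).symm

theorem isDensity_attachEve {a b e : Type*} [Fintype a] [Fintype b] [Fintype e]
    {ρ : Matrix (a × b) (a × b) ℂ} {σ : Matrix e e ℂ} (hρ : IsDensity ρ) (hσ : IsDensity σ) :
    IsDensity (attachEve ρ σ) := by
  refine ⟨(hρ.1.kronecker hσ.1).submatrix _, ?_⟩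
  have h : (attachEve ρ σ).trace = (ρ ⊗ₖ σ).trace :=
    trace_submatrix_equiv _ _
  rw [h, Matrix.trace_kronecker, hρ.2, hσ.2, one_mul]

theorem steered_attachEve {a b e : Type*} [Fintype b] [Fintype e]
    (ρ : Matrix (a × b) (a × b) ℂ) (σ : Matrix e e ℂ) (B : Matrix b b ℂ) (E : Matrix e e ℂ) :
    steered (attachEve ρ σ) (B ⊗ₖ E) = (E * σ).trace • steered ρ B := by
  rw [Matrix.trace_mul_comm]
  ext i j
  simp only [steered, attachEve, Matrix.of_apply, Fintype.sum_prod_type, Matrix.submatrix_apply,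
    Equiv.prodAssoc_symm_apply, Matrix.kronecker_apply, Matrix.smul_apply, smul_eq_mul,
    Matrix.trace, Matrix.diag_apply, Matrix.mul_apply]
  rw [Finset.mul_sum]
  refine Finset.sum_congr rfl fun f _ => ?_
  rw [Finset.mul_sum, Finset.sum_comm]
  refine Finset.sum_congr rfl fun f' _ => ?_
  simp_rw [Finset.sum_mul]
  refine Finset.sum_congr rfl fun x _ => Finset.sum_congr rfl fun y _ => ?_
  ring

namespace Realization

variable (Q : Realization d ι)

/-- The state of Alice and Bob. -/
def stateAB : Matrix (Fin d × Fin Q.dimB) (Fin d × Fin Q.dimB) ℂ :=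
  steered (Q.ρ.submatrix (Equiv.prodAssoc _ _ _) (Equiv.prodAssoc _ _ _)) 1

theorem isDensity_stateAB : IsDensity Q.stateAB := by
  refine ⟨Steering.posSemidef_steered (Q.isDensity.1.submatrix _) .one, ?_⟩
  rw [stateAB, steered_one_one_trace, ← Q.isDensity.2]
  exact trace_submatrix_equiv _ _

theorem steered_stateAB (B : Matrix (Fin Q.dimB) (Fin Q.dimB) ℂ) :
    steered Q.stateAB B = steered Q.ρ (B ⊗ₖ 1) := by
  ext i j
  simp only [steered, stateAB, Matrix.of_apply, Fintype.sum_prod_type, Matrix.submatrix_apply,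
    Equiv.prodAssoc_apply, Matrix.kronecker_apply, Matrix.one_apply, mul_ite, mul_one, mul_zero,
    Finset.sum_ite_eq', Finset.mem_univ, if_true, Finset.sum_mul]
  refine Finset.sum_congr rfl fun f _ => ?_
  rw [Finset.sum_comm]

/-- The reshuffling that puts Eve's system first. -/
def eveFirst : Fin Q.dimE × (Fin d × Fin Q.dimB) ≃ Fin d × (Fin Q.dimB × Fin Q.dimE) :=
  (Equiv.prodComm _ _).trans (Equiv.prodAssoc _ _ _)

/-- The state of Eve. -/
def stateE : Matrix (Fin Q.dimE) (Fin Q.dimE) ℂ :=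
  steered (Q.ρ.submatrix Q.eveFirst Q.eveFirst) 1

theorem isDensity_stateE : IsDensity Q.stateE := by
  refine ⟨Steering.posSemidef_steered (Q.isDensity.1.submatrix _) .one, ?_⟩
  rw [stateE, steered_one_one_trace, ← Q.isDensity.2]
  exact trace_submatrix_equiv _ _

theorem trace_mul_stateE (E : Matrix (Fin Q.dimE) (Fin Q.dimE) ℂ) :
    (E * Q.stateE).trace = (steered Q.ρ (1 ⊗ₖ E)).trace := by
  have h1 : E ⊗ₖ (1 : Matrix (Fin d × Fin Q.dimB) (Fin d × Fin Q.dimB) ℂ) =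
      ((1 : Matrix (Fin d) (Fin d) ℂ) ⊗ₖ ((1 : Matrix (Fin Q.dimB) (Fin Q.dimB) ℂ) ⊗ₖ E)).submatrix
        Q.eveFirst Q.eveFirst := by
    ext ⟨e, a, b⟩ ⟨e', a', b'⟩
    simp only [eveFirst, Matrix.kronecker_apply, Matrix.submatrix_apply, Equiv.trans_apply,
      Equiv.prodComm_apply, Prod.swap_prod_mk, Equiv.prodAssoc_apply, Matrix.one_apply,
      Prod.mk.injEq]
    split_ifs <;> simp_all
  have h2 := trace_mul_kronecker Q.ρ 1 ((1 : Matrix (Fin Q.dimB) (Fin Q.dimB) ℂ) ⊗ₖ E)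
  rw [mul_one] at h2
  rw [Matrix.trace_mul_comm, stateE, ← h2, ← trace_mul_kronecker, h1, Matrix.submatrix_mul_equiv]
  exact trace_submatrix_equiv _ _

/-- The realization in which Eve's system is replaced by an uncorrelated state `σ`. -/
def replaceEve {n : ℕ} {σ : Matrix (Fin n) (Fin n) ℂ} (hσ : IsDensity σ) : Realization d ι where
  dimB := Q.dimB
  dimE := n
  ρ := attachEve Q.stateAB σ
  isDensity := isDensity_attachEve Q.isDensity_stateAB hσ
  N := Q.N
  N_mem := Q.N_mem
  R := Q.R
  R_mem := Q.R_mem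

theorem steered_replaceEve {n : ℕ} {σ : Matrix (Fin n) (Fin n) ℂ} (hσ : IsDensity σ)
    (B : Matrix (Fin Q.dimB) (Fin Q.dimB) ℂ) (E : Matrix (Fin n) (Fin n) ℂ) :
    steered (Q.replaceEve hσ).ρ (B ⊗ₖ E) = (E * σ).trace • steered Q.ρ (B ⊗ₖ 1) := by
  rw [← steered_stateAB]
  exact steered_attachEve _ _ _ _

theorem corr_replaceEve [NeZero d] {n : ℕ} {σ : Matrix (Fin n) (Fin n) ℂ} (hσ : IsDensity σ) :
    (Q.replaceEve hσ).corr = Q.corr := by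
  have h : ∀ (A : Matrix (Fin d) (Fin d) ℂ) (B : Matrix (Fin Q.dimB) (Fin Q.dimB) ℂ),
      (Q.replaceEve hσ).tr A B (1 : Matrix (Fin n) (Fin n) ℂ) = Q.tr A B 1 := fun A B => by
    refine ((Q.replaceEve hσ).tr_eq A B (1 : Matrix (Fin n) (Fin n) ℂ)).trans ?_
    rw [tr_eq]
    congr 2
    refine (Q.steered_replaceEve hσ B 1).trans ?_
    rw [one_mul, hσ.2, one_smul]
  ext x
  · exact congrArg Complex.re (h _ _)
  · exact congrArg Complex.re (h _ _)

end Realization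

end Eve

/-! ### The reference realization -/

section ReferenceRealization

variable {d : ℕ} {ι : Type} [Fintype ι]

/-- Bob's measurements in the reference realization. -/
def refMeas (d : ℕ) (y : Fin 2) (b : Fin d) : Matrix (Fin d) (Fin d) ℂ :=
  if y = 0 then Matrix.diagonal (Pi.single (-b) 1)
  else (d : ℂ)⁻¹ • ketbra fun k => (chi b k)⁻¹

theorem refMeas_one_apply (b j k : Fin d) :
    refMeas d 1 b j k = (d : ℂ)⁻¹ * ((chi b j)⁻¹ * chi b k) := by
  simp [refMeas, ketbra, Matrix.vecMulVec_apply, star_chi]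

variable [NeZero d]

theorem sum_chi_mul_inv_left (j k : Fin d) :
    ∑ b : Fin d, (chi b j)⁻¹ * chi b k = if j = k then (d : ℂ) else 0 := by
  simp_rw [mul_comm (chi _ j)⁻¹, sum_chi_mul_inv, eq_comm]

theorem refMeas_mem_povms (y : Fin 2) : refMeas d y ∈ povms (Fin d) (Fin d) := by
  have hd' : (d : ℂ) ≠ 0 := by exact_mod_cast NeZero.ne d
  fin_cases y
  · refine ⟨fun b => ?_, ?_⟩
    · exact Matrix.PosSemidef.diagonal (Pi.single_nonneg.2 zero_le_one)
    · ext j k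
      simp only [refMeas, Fin.zero_eta, if_true, Matrix.sum_apply, Matrix.diagonal_apply,
        Matrix.one_apply]
      split_ifs with h
      · simp_rw [Pi.single_apply, ← neg_eq_iff_eq_neg]; simp
      · simp
  · refine ⟨fun b => (posSemidef_ketbra _).smul (by positivity), ?_⟩
    ext j k
    rw [Matrix.sum_apply]
    refine (Finset.sum_congr rfl fun b _ => refMeas_one_apply b j k).trans ?_
    rw [← Finset.mul_sum, sum_chi_mul_inv_left, Matrix.one_apply]
    split_ifs <;> simp [hd']

/-- The reference realization: the state `ψ(α)`, a trivial Eve, and a third POVM `I` of Bob. -/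
def refRealization {α : Fin d → ℝ} (hα : IsSchmidt α) {I : ι → Matrix (Fin d) (Fin d) ℂ}
    (hI : I ∈ povms ι (Fin d)) : Realization d ι where
  dimB := d
  dimE := 1
  ρ := attachEve (ketbra (psi α)) 1
  isDensity := isDensity_attachEve (isDensity_ketbra_psi hα) ⟨.one, by simp⟩
  N := refMeas d
  N_mem := refMeas_mem_povms
  R := I
  R_mem := hI

variable {α : Fin d → ℝ} (hα : IsSchmidt α) {I : ι → Matrix (Fin d) (Fin d) ℂ}
  (hI : I ∈ povms ι (Fin d))

theorem steered_refRealization (B : Matrix (Fin d) (Fin d) ℂ) :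
    steered (refRealization hα hI).ρ (B ⊗ₖ (1 : Matrix (Fin 1) (Fin 1) ℂ)) = twist α B := by
  refine (steered_attachEve (ketbra (psi α)) (1 : Matrix (Fin 1) (Fin 1) ℂ) B 1).trans ?_
  simp [steered_ketbra_psi]

/-- For `y = 0` the steered operator is supported on `|-b⟩`. For `y = 1` it is the rank-one operator
with entries `α_j α_k / d` up to characters, and both halves of its gap equal `(∑ α_i)² / d`. -/
theorem steeringValue_refRealization (hd : 2 ≤ d) :
    steeringValue α (refRealization hα hI).corr = d := by
  have hd' : (d : ℂ) ≠ 0 := by exact_mod_cast NeZero.ne d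
  have h0 : ∀ b : Fin d,
      (twist α (refMeas d 0 b)).trace - twist α (refMeas d 0 b) (-b) (-b) = 0 := by
    intro b
    rw [trace_sub_apply]
    refine Finset.sum_eq_zero fun j hj => ?_
    simp [twist, refMeas, Finset.ne_of_mem_erase hj]
  have h1 : ∀ b : Fin d, steeringGap α (-b) (twist α (refMeas d 1 b)) = 0 := by
    intro b
    have e1 : ∀ j k, chi (-b) j * twist α (refMeas d 1 b) j k * (chi (-b) k)⁻¹ =
        (d : ℂ)⁻¹ * (α j * α k) := by
      intro j k
      have := chi_ne_zero b j
      have := chi_ne_zero b k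
      rw [chi_comm (-b), chi_comm (-b), chi_neg, chi_neg, chi_comm j, chi_comm k, twist,
        Matrix.of_apply, refMeas_one_apply]
      field_simp
    have e2 : ∀ j, twist α (refMeas d 1 b) j j / α j = (d : ℂ)⁻¹ * α j := by
      intro j
      have : (α j : ℂ) ≠ 0 := by exact_mod_cast (hα.1 j).ne'
      have := chi_ne_zero b j
      rw [twist, Matrix.of_apply, refMeas_one_apply]
      field_simp
    simp_rw [steeringGap, e1, e2, ← Finset.mul_sum, ← Finset.sum_mul]
    ring
  have h := (refRealization hα hI).sub_steeringValue_corr_eq hd hα.1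
  have e0 : ∀ b, steered (refRealization hα hI).ρ ((refRealization hα hI).N 0 b ⊗ₖ
      (1 : Matrix (Fin 1) (Fin 1) ℂ)) = twist α (refMeas d 0 b) :=
    fun b => steered_refRealization hα hI _
  have e1 : ∀ b, steered (refRealization hα hI).ρ ((refRealization hα hI).N 1 b ⊗ₖ
      (1 : Matrix (Fin 1) (Fin 1) ℂ)) = twist α (refMeas d 1 b) :=
    fun b => steered_refRealization hα hI _
  have h' : d - steeringValue α (refRealization hα hI).corr =
      (d * ∑ b : Fin d, ((twist α (refMeas d 0 b)).trace - twist α (refMeas d 0 b) (-b) (-b)) +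
        (gammaCoeff α : ℂ) * ∑ b : Fin d, steeringGap α (-b) (twist α (refMeas d 1 b))).re := by
    simp_rw [← e0, ← e1]
    exact h
  simp only [h0, h1, Finset.sum_const_zero, mul_zero, add_zero, Complex.zero_re] at h'
  linarith

theorem certifiedBy_refRealization (hd : 2 ≤ d) : (refRealization hα hI).CertifiedBy α I where
  maximal := ⟨⟨_, rfl⟩, by
    rintro _ ⟨Q, rfl⟩
    rw [steeringValue_refRealization hα hI hd]
    exact Q.steeringValue_le hd hα.1⟩
  povm x b := by
    rw [Realization.tr_eq, expect_psi]
    congr 2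
    exact steered_refRealization hα hI _

end ReferenceRealization

/-! ### Eve's guessing probability -/

section Guessing

variable {d : ℕ} [NeZero d] {ι : Type} [Fintype ι] {α : Fin d → ℝ}
  {I : ι → Matrix (Fin d) (Fin d) ℂ}

namespace Realization.CertifiedBy

variable {Q : Realization d ι}

theorem le_steeringValue (hd : 2 ≤ d) (hα : IsSchmidt α) (hI : I ∈ povms ι (Fin d))
    (hQ : Q.CertifiedBy α I) : (d : ℝ) ≤ steeringValue α Q.corr := by
  rw [← steeringValue_refRealization hα hI hd]
  exact hQ.maximal.2 ⟨_, rfl⟩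

/-- Both operators have the same traces against all `X^i Z^j`. -/
theorem steered_R_one (hQ : Q.CertifiedBy α I) (b : ι) :
    steered Q.ρ (Q.R b ⊗ₖ 1) = twist α (I b) :=
  eq_of_trace_mul_weyl fun x => by rw [← tr_eq, ← expect_psi, hQ.povm]

theorem of_corr_eq (hd : 2 ≤ d) (hQ : Q.CertifiedBy α I) {S : Realization d ι}
    (hS : S.corr = Q.corr) : S.CertifiedBy α I where
  maximal := hS ▸ hQ.maximal
  povm x b := by rw [← hQ.povm, tr_weyl_eq hd, tr_weyl_eq hd, hS]

/-- Extremality of `I` decouples Eve from Bob's third measurement. -/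
theorem steered_R_eq (hd : 2 ≤ d) (hα : IsSchmidt α) (hI : IsExtremalPOVM I)
    (hQ : Q.CertifiedBy α I) {E : Matrix (Fin Q.dimE) (Fin Q.dimE) ℂ} (hE : E.PosSemidef)
    (hE' : (1 - E).PosSemidef) (b : ι) :
    steered Q.ρ (Q.R b ⊗ₖ E) = (E * Q.stateE).trace • twist α (I b) := by
  rw [trace_mul_stateE]
  set q := (steered Q.ρ (1 ⊗ₖ E)).trace with hq
  have hone : steered Q.ρ (1 ⊗ₖ E) = q • twist α 1 := by
    rw [twist_one, hq]
    exact Q.steered_one_eq hd hα (hQ.le_steeringValue hd hα hI.1) hE hE'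
  have hq0 : 0 ≤ q := (posSemidef_steered .one hE).trace_nonneg
  have hq1 : 0 ≤ 1 - q := by
    have h := (posSemidef_steered (Q := Q) .one hE').trace_nonneg
    rwa [eq_sub_of_add_eq' (steered_add_compl 1 E), Matrix.trace_sub, trace_steered_one] at h
  have p := fun b => posSemidef_steered (Q.R_mem.1 b) hE
  have p' := fun b => posSemidef_steered (Q.R_mem.1 b) hE'
  have hG := fun b => (steered_add_compl (Q.R b) E).trans (hQ.steered_R_one b)
  have hG0 : ∀ b, (twist α (I b)).PosSemidef := fun b => hG b ▸ (p b).add (p' b)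
  -- The perturbation is the deviation of the effects conditioned on `E` from `q • I b`. Adding it
  -- to `I b` gives `(1 - q) • I b` plus a positive operator steered by `E`; subtracting it gives `q
  -- • I b` plus one steered by `1 - E`.
  have hX := hI.eq_zero
    (X := fun b => untwist α (steered Q.ρ (Q.R b ⊗ₖ E) - q • twist α (I b)))
    (fun b => by
      have h : twist α (I b) + (steered Q.ρ (Q.R b ⊗ₖ E) - q • twist α (I b)) =
          (1 - q) • twist α (I b) + steered Q.ρ (Q.R b ⊗ₖ E) := by rw [sub_smul, one_smul]; abel
      rw [show I b + _ = _ from congrArg (· + _) (untwist_twist hα.1 (I b)).symm, ← untwist_add,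
        h]
      exact posSemidef_untwist (((hG0 b).smul hq1).add (p b)))
    (fun b => by
      have h : twist α (I b) - (steered Q.ρ (Q.R b ⊗ₖ E) - q • twist α (I b)) =
          q • twist α (I b) + steered Q.ρ (Q.R b ⊗ₖ (1 - E)) := by
        rw [← hG b]; abel
      rw [show I b - _ = _ from congrArg (· - _) (untwist_twist hα.1 (I b)).symm, ← untwist_sub, h]
      exact posSemidef_untwist (((hG0 b).smul hq0).add (p' b)))
    (by
      -- The deviations sum to zero because rigidity identifies Alice's state conditioned on `E` as
      -- `q • twist α 1`.
      rw [← untwist_sum, Finset.sum_sub_distrib, sum_steered Q.R_mem, ← Finset.smul_sum,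
        ← twist_sum, hI.1.2, hone, sub_self]
      ext; simp [untwist])
  have h := congrArg (twist α) (congrFun hX b)
  rw [twist_untwist hα.1] at h
  refine sub_eq_zero.1 (h.trans ?_)
  ext; simp [twist]

theorem guess_eq (hd : 2 ≤ d) (hα : IsSchmidt α) (hI : IsExtremalPOVM I)
    (hQ : Q.CertifiedBy α I) {E : ι → Matrix (Fin Q.dimE) (Fin Q.dimE) ℂ}
    (hE : E ∈ povms ι (Fin Q.dimE)) :
    Q.guess E = (∑ b, (I b * rhoB α).trace * (E b * Q.stateE).trace).re := by
  rw [Realization.guess_eq, Complex.re_sum]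
  refine Finset.sum_congr rfl fun b _ => ?_
  rw [hQ.steered_R_eq hd hα hI (hE.1 b) (PosSemidef.one_sub_of_mem_povms hE b), Matrix.trace_smul,
    smul_eq_mul, trace_mul_rhoB, mul_comm]

theorem guess_replaceEve (hQ : Q.CertifiedBy α I) {n : ℕ} {σ : Matrix (Fin n) (Fin n) ℂ}
    (hσ : IsDensity σ) (E : ι → Matrix (Fin n) (Fin n) ℂ) :
    (Q.replaceEve hσ).guess E = (∑ b, (I b * rhoB α).trace * (E b * σ).trace).re := by
  refine ((Q.replaceEve hσ).guess_eq E).trans ?_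
  rw [Complex.re_sum]
  refine Finset.sum_congr rfl fun b _ => ?_
  have h : steered (Q.replaceEve hσ).ρ ((Q.replaceEve hσ).R b ⊗ₖ E b) =
      (E b * σ).trace • steered Q.ρ (Q.R b ⊗ₖ 1) := Q.steered_replaceEve hσ (Q.R b) (E b)
  refine (congrArg (fun M => (Matrix.trace M).re) h).trans ?_
  rw [hQ.steered_R_one, Matrix.trace_smul, smul_eq_mul, trace_mul_rhoB, mul_comm]

/-- The two suprema are over the same set: decoupling gives one inclusion with `σ` Eve's reduced
state, and `replaceEve` gives the other. -/
theorem guessingProb_eq (hd : 2 ≤ d) (hα : IsSchmidt α) (hI : IsExtremalPOVM I)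
    (hQ : Q.CertifiedBy α I) : guessingProb Q.corr = reducedGuessingProb α I := by
  rw [guessingProb, reducedGuessingProb]
  congr 1
  ext g
  constructor
  · rintro ⟨S, E, hS, hE, rfl⟩
    exact ⟨S.dimE, S.stateE, E, S.isDensity_stateE, hE,
      (hQ.of_corr_eq hd hS).guess_eq hd hα hI hE⟩
  · rintro ⟨n, σ, E, hσ, hE, rfl⟩
    exact ⟨Q.replaceEve hσ, E, Q.corr_replaceEve hσ, hE, (hQ.guess_replaceEve hσ E).symm⟩

theorem guess_eq_of_uniform (hd : 2 ≤ d) (hα : IsSchmidt α) (hI : IsExtremalPOVM I)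
    (hQ : Q.CertifiedBy α I) (hu : ∀ b, (I b * rhoB α).trace = 1 / (d : ℂ) ^ 2)
    {E : ι → Matrix (Fin Q.dimE) (Fin Q.dimE) ℂ} (hE : E ∈ povms ι (Fin Q.dimE)) :
    Q.guess E = 1 / (d : ℝ) ^ 2 := by
  rw [hQ.guess_eq hd hα hI hE]
  simp_rw [hu, ← Finset.mul_sum, ← Matrix.trace_sum, ← Matrix.sum_mul, hE.2, one_mul,
    Q.isDensity_stateE.2, mul_one]
  rw [← Complex.ofReal_natCast, ← Complex.ofReal_pow, ← Complex.ofReal_one, ← Complex.ofReal_div,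
    Complex.ofReal_re]

theorem guessingProb_eq_of_uniform [Nonempty ι] (hd : 2 ≤ d) (hα : IsSchmidt α)
    (hI : IsExtremalPOVM I) (hQ : Q.CertifiedBy α I)
    (hu : ∀ b, (I b * rhoB α).trace = 1 / (d : ℂ) ^ 2) :
    guessingProb Q.corr = 1 / (d : ℝ) ^ 2 := by
  classical
  have hset : {g : ℝ | ∃ (S : Realization d ι) (E : ι → Matrix (Fin S.dimE) (Fin S.dimE) ℂ),
      S.corr = Q.corr ∧ E ∈ povms ι (Fin S.dimE) ∧ g = S.guess E} = {1 / (d : ℝ) ^ 2} := by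
    ext g
    constructor
    · rintro ⟨S, E, hS, hE, rfl⟩
      exact (hQ.of_corr_eq hd hS).guess_eq_of_uniform hd hα hI hu hE
    · rintro rfl
      -- Eve always announces one fixed outcome; this strategy shows that the set is nonempty.
      have hE : (Pi.single (Classical.arbitrary ι) 1 : ι → Matrix (Fin Q.dimE) (Fin Q.dimE) ℂ) ∈
          povms ι (Fin Q.dimE) := by
        refine ⟨fun b => ?_, by simp⟩
        rw [Pi.single_apply]
        split_ifs
        · exact .one
        · exact .zero
      exact ⟨Q, _, rfl, hE, (hQ.guess_eq_of_uniform hd hα hI hu hE).symm⟩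
  rw [guessingProb, hset, csSup_singleton]

end Realization.CertifiedBy

theorem minEntropy_eq {p : Correlations d ι} (h : guessingProb p = 1 / (d : ℝ) ^ 2) :
    minEntropy p = 2 * Real.logb 2 d := by
  rw [minEntropy, h, one_div, Real.logb_inv, neg_neg, Real.logb_pow]
  norm_num

end Guessing

/-! ### The Weyl-covariant POVM -/

section WeylPOVM

variable {d : ℕ}

/-- The Fourier coefficients of `t ↦ ν (t + m) * conj (ν t)`. -/
def overlap (ν : Fin d → ℂ) (m l : Fin d) : ℂ :=
  ∑ t, (chi l t)⁻¹ * (ν (t + m) * star (ν t))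

variable [NeZero d] {ν : Fin d → ℂ}

theorem weyl_mulVec (x : Fin d × Fin d) (r : Fin d) :
    (weyl d x *ᵥ ν) r = chi x.2 (r - x.1) * ν (r - x.1) := by
  simp only [Matrix.mulVec, dotProduct, weyl_apply]
  rw [Finset.sum_eq_single (r - x.1)]
  · simp
  · intro c _ hc
    rw [if_neg, zero_mul]
    rintro rfl
    simp at hc
  · simp

theorem weylPOVM_eq (x : Fin d × Fin d) :
    weylPOVM ν x = ketbra fun r => ((√(d : ℝ) : ℝ) : ℂ)⁻¹ * (weyl d x *ᵥ ν) r := by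
  have h : ((√(d : ℝ) : ℝ) : ℂ)⁻¹ * ((√(d : ℝ) : ℝ) : ℂ)⁻¹ = (d : ℂ)⁻¹ := by
    rw [← mul_inv, ← Complex.ofReal_mul, Real.mul_self_sqrt (Nat.cast_nonneg d),
      Complex.ofReal_natCast]
  ext r s
  rw [weylPOVM, ketbra, Matrix.mul_vecMulVec, Matrix.vecMulVec_mul, ← Matrix.star_mulVec,
    Matrix.smul_apply, ketbra, Matrix.vecMulVec_apply, Matrix.vecMulVec_apply, ← h]
  simp only [Pi.star_apply, star_mul', star_inv₀, smul_eq_mul, Complex.star_def,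
    Complex.conj_ofReal]
  ring

theorem weylPOVM_apply (x : Fin d × Fin d) (r s : Fin d) :
    weylPOVM ν x r s = (d : ℂ)⁻¹ * ((chi x.2 (r - x.1) * (chi x.2 (s - x.1))⁻¹) *
      (ν (r - x.1) * star (ν (s - x.1)))) := by
  rw [weylPOVM, ketbra, Matrix.mul_vecMulVec, Matrix.vecMulVec_mul, ← Matrix.star_mulVec,
    Matrix.smul_apply, Matrix.vecMulVec_apply, Pi.star_apply, weyl_mulVec, weyl_mulVec, star_mul',
    star_chi, smul_eq_mul]
  ring

/-- Summing over the powers of `Z` removes the off-diagonal entries; summing over the shifts turns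
each diagonal entry into the squared norm of `ν`. -/
theorem sum_weylPOVM (hν : star ν ⬝ᵥ ν = 1) : ∑ x, weylPOVM ν x = 1 := by
  have hd' : (d : ℂ) ≠ 0 := by exact_mod_cast NeZero.ne d
  ext r s
  simp_rw [Matrix.sum_apply, weylPOVM_apply, Fintype.sum_prod_type, ← Finset.mul_sum,
    ← Finset.sum_mul, sum_chi_mul_inv, sub_left_inj, Matrix.one_apply]
  split_ifs with h
  · subst h
    rw [← Finset.mul_sum, inv_mul_cancel_left₀ hd', ← hν, dotProduct]
    refine Fintype.sum_equiv (Equiv.subLeft r) _ _ fun i => ?_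
    simp [mul_comm]
  · simp

theorem trace_weyl_mul_ketbra (x : Fin d × Fin d) :
    ((weyl d x)ᴴ * ketbra ν).trace = overlap ν x.1 x.2 := by
  rw [ketbra, Matrix.mul_vecMulVec, Matrix.trace_vecMulVec, dotProduct, overlap]
  refine Finset.sum_congr rfl fun t _ => ?_
  have h : ((weyl d x)ᴴ *ᵥ ν) t = (chi x.2 t)⁻¹ * ν (t + x.1) := by
    simp only [Matrix.mulVec, dotProduct, Matrix.conjTranspose_apply, weyl_apply]
    rw [Finset.sum_eq_single (t + x.1)]
    · simp [← star_chi]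
    · intro c _ hc
      simp [hc]
    · simp
  rw [h, Pi.star_apply, mul_assoc]

/-- On the cyclic diagonal with offset `m`, the relation says that the convolution of the
`j`-Fourier transform of `c` with `t ↦ ν (t + m) * star (ν t)` is zero. A second transform makes it
a product whose known factor `overlap ν m l` is nonzero, so both transforms can be inverted. -/
theorem eq_zero_of_sum_smul_weylPOVM (hν : ∀ m l, overlap ν m l ≠ 0) (c : Fin d × Fin d → ℂ)
    (hc : ∑ x, c x • weylPOVM ν x = 0) : c = 0 := by
  have hd' : (d : ℂ) ≠ 0 := by exact_mod_cast NeZero.ne d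
  have h1 : ∀ m s, ∑ i, (∑ j, c (i, j) * chi m j) * (ν (s - i + m) * star (ν (s - i))) = 0 := by
    intro m s
    have h := congrFun (congrFun hc (s + m)) s
    rw [Matrix.sum_apply] at h
    simp_rw [Matrix.smul_apply, weylPOVM_apply, ← chi_sub, Fintype.sum_prod_type, smul_eq_mul,
      mul_left_comm _ (d : ℂ)⁻¹, ← Finset.mul_sum] at h
    have h := (mul_eq_zero.1 h).resolve_left (inv_ne_zero hd')
    rw [← h]
    refine Finset.sum_congr rfl fun i _ => ?_
    rw [Finset.sum_mul]
    refine Finset.sum_congr rfl fun j _ => ?_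
    have e1 : s + m - i - (s - i) = m := by abel
    have e2 : s + m - i = s - i + m := by abel
    rw [e1, e2, chi_comm m, mul_assoc]
  have h2 : ∀ m l, ∑ i, (∑ j, c (i, j) * chi m j) * chi (-l) i = 0 := by
    intro m l
    -- Fourier transform of the convolution `h1` in `s`.
    have h : ∑ s, (chi l s)⁻¹ *
        ∑ i, (∑ j, c (i, j) * chi m j) * (ν (s - i + m) * star (ν (s - i))) = 0 := by
      simp_rw [h1, mul_zero, Finset.sum_const_zero]
    simp_rw [Finset.mul_sum] at h
    rw [Finset.sum_comm] at h
    have e : ∀ i, ∑ s, (chi l s)⁻¹ *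
        ((∑ j, c (i, j) * chi m j) * (ν (s - i + m) * star (ν (s - i)))) =
        (∑ j, c (i, j) * chi m j) * chi (-l) i * overlap ν m l := by
      intro i
      rw [overlap, Finset.mul_sum]
      refine Fintype.sum_equiv (Equiv.subRight i) _ _ fun s => ?_
      have := chi_ne_zero l i
      have := chi_ne_zero l s
      rw [Equiv.subRight_apply, chi_comm (-l), chi_neg, chi_comm i, chi_sub]
      field_simp
    simp_rw [e, ← Finset.sum_mul] at h
    exact (mul_eq_zero.1 h).resolve_right (hν m l)
  funext ⟨i, j⟩
  have h3 : ∀ m, (fun i => ∑ j, c (i, j) * chi m j) = 0 := fun m =>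
    eq_zero_of_sum_chi _ fun l => by simpa using h2 m (-l)
  exact congrFun (eq_zero_of_sum_chi (fun j => c (i, j)) fun m => congrFun (h3 m) i) j

theorem IsFiducial.overlap_ne_zero (hν : IsFiducial ν) (m l : Fin d) : overlap ν m l ≠ 0 := by
  rw [← trace_weyl_mul_ketbra (m, l)]
  exact hν.2 (m, l)

theorem IsFiducial.isExtremalPOVM (hν : IsFiducial ν) : IsExtremalPOVM (weylPOVM ν) := by
  have h : weylPOVM ν = fun x => ketbra fun r => ((√(d : ℝ) : ℝ) : ℂ)⁻¹ * (weyl d x *ᵥ ν) r :=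
    funext weylPOVM_eq
  have hs := sum_weylPOVM hν.1
  have hli := eq_zero_of_sum_smul_weylPOVM hν.overlap_ne_zero
  rw [h] at hs hli ⊢
  exact isExtremalPOVM_of_linearIndependent hs hli

theorem isSchmidt_maxEnt : IsSchmidt (maxEnt d) := by
  have hd : (0 : ℝ) < d := by exact_mod_cast Nat.pos_of_ne_zero (NeZero.ne d)
  refine ⟨fun _ => by rw [maxEnt]; positivity, ?_⟩
  simp [maxEnt, inv_pow, Real.sq_sqrt hd.le, hd.ne']

theorem trace_weylPOVM_mul_rhoB (hν : star ν ⬝ᵥ ν = 1) (x : Fin d × Fin d) :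
    (weylPOVM ν x * rhoB (maxEnt d)).trace = 1 / (d : ℂ) ^ 2 := by
  have h1 : rhoB (maxEnt d) = (d : ℂ)⁻¹ • (1 : Matrix (Fin d) (Fin d) ℂ) := by
    rw [rhoB_eq, ← Matrix.diagonal_one, ← Matrix.diagonal_smul]
    congr 1
    funext i
    simp only [maxEnt, Pi.smul_apply, smul_eq_mul, mul_one, ← Complex.ofReal_pow, div_pow, one_pow,
      Real.sq_sqrt (Nat.cast_nonneg d)]
    simp
  have h2 : (weylPOVM ν x).trace = (d : ℂ)⁻¹ := by
    rw [weylPOVM, Matrix.trace_smul, Matrix.trace_mul_comm, ← Matrix.mul_assoc,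
      ← Matrix.star_eq_conjTranspose, Matrix.mem_unitaryGroup_iff'.1 (weyl_mem_unitaryGroup x),
      one_mul, ketbra, Matrix.trace_vecMulVec, dotProduct_comm, hν, smul_eq_mul, mul_one]
  rw [h1, Matrix.mul_smul, mul_one, Matrix.trace_smul, h2, smul_eq_mul]
  ring

end WeylPOVM

/-! ### Existence of fiducial vectors -/

section Fiducial

variable {d : ℕ}

theorem overlap_smul (r : ℝ) (ν : Fin d → ℂ) (m l : Fin d) :
    overlap (fun t => (r : ℂ) * ν t) m l = (r : ℂ) ^ 2 * overlap ν m l := by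
  rw [overlap, overlap, Finset.mul_sum]
  refine Finset.sum_congr rfl fun t _ => ?_
  rw [star_mul', Complex.star_def, Complex.conj_ofReal]
  ring

variable [NeZero d]

theorem overlap_zero_zero (ν : Fin d → ℂ) :
    overlap ν 0 0 = ((∑ t, ‖ν t‖ ^ 2 : ℝ) : ℂ) := by
  simp [overlap, Complex.mul_conj']

theorem dotProduct_eq_overlap (ν : Fin d → ℂ) : star ν ⬝ᵥ ν = overlap ν 0 0 := by
  simp [overlap, dotProduct, mul_comm]

theorem exists_isFiducial_of_overlap {ν : Fin d → ℂ} (hν : ∀ m l, overlap ν m l ≠ 0) :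
    ∃ ν : Fin d → ℂ, IsFiducial ν := by
  set r := ∑ t, ‖ν t‖ ^ 2 with hr
  have h0 : overlap ν 0 0 = (r : ℂ) := overlap_zero_zero ν
  have hr0 : r ≠ 0 := fun h => hν 0 0 (by rw [h0, h, Complex.ofReal_zero])
  have hrn : 0 ≤ r := Finset.sum_nonneg fun t _ => by positivity
  have hs : √r ≠ 0 := (Real.sqrt_ne_zero hrn).2 hr0
  refine ⟨fun t => (((√r)⁻¹ : ℝ) : ℂ) * ν t, ?_, fun x => ?_⟩
  · rw [dotProduct_eq_overlap, overlap_smul, h0, ← Complex.ofReal_pow, ← Complex.ofReal_mul,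
      inv_pow, Real.sq_sqrt hrn, inv_mul_cancel₀ hr0, Complex.ofReal_one]
  · rw [trace_weyl_mul_ketbra, overlap_smul]
    exact mul_ne_zero (pow_ne_zero _ (Complex.ofReal_ne_zero.2 (inv_ne_zero hs))) (hν _ _)

/-- The direction in which the basis vector `|0⟩` is perturbed. -/
def tilt (t : Fin d) : ℂ := (1 + Complex.I) * (t : ℕ)

/-- The vector `|0⟩ + ε |tilt⟩`. -/
def perturb (ε : ℝ) (t : Fin d) : ℂ := (if t = 0 then 1 else 0) + ε * tilt t

theorem overlap_perturb (m l : Fin d) (ε : ℝ) :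
    overlap (perturb ε) m l =
      (if m = 0 then 1 else 0) + ε * (tilt m + chi l m * star (tilt (-m)) +
        ε * overlap tilt m l) := by
  have h1 : ∀ t : Fin d, (chi l t)⁻¹ * (perturb ε (t + m) * star (perturb ε t)) =
      (chi l t)⁻¹ * ((if t = -m then 1 else 0) * (if t = 0 then 1 else 0)) +
      ε * ((chi l t)⁻¹ * tilt (t + m) * (if t = 0 then 1 else 0)) +
      ε * ((chi l t)⁻¹ * star (tilt t) * (if t = -m then 1 else 0)) +
      ε * ε * ((chi l t)⁻¹ * (tilt (t + m) * star (tilt t))) := by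
    intro t
    have hε : star (ε : ℂ) = ε := Complex.conj_ofReal ε
    rw [perturb, perturb, star_add, star_mul', hε, apply_ite star, star_one, star_zero]
    simp only [add_eq_zero_iff_eq_neg]
    ring
  rw [overlap, Finset.sum_congr rfl fun t _ => h1 t]
  simp_rw [Finset.sum_add_distrib, ← Finset.mul_sum]
  rw [← overlap]
  simp [chi_neg, eq_comm (a := m)]
  ring

/-- This is the first-order term of the overlap for `m ≠ 0`. If it vanished, comparing moduli would
give `d - m = m`, so `chi l m` would square to `1`; but the factor `1 + i` in `tilt` would then
force it to be `-i`. -/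
theorem tilt_add_ne_zero {m : Fin d} (hm : m ≠ 0) (l : Fin d) :
    tilt m + chi l m * star (tilt (-m)) ≠ 0 := by
  intro h
  have hmv : (m : ℕ) ≠ 0 := fun h => hm (Fin.ext (by simpa using h))
  have hneg : (((-m : Fin d) : ℕ) : ℂ) = ((d - m : ℕ) : ℂ) := by
    rw [Fin.val_neg, if_neg hm]
  have h' : (1 + Complex.I) * (m : ℕ) + chi l m * ((1 - Complex.I) * ((d - m : ℕ) : ℂ)) = 0 := by
    rw [tilt, tilt, hneg] at h
    simpa [← sub_eq_add_neg] using h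
  -- Division by `1 - i`, whose inverse is `(1 + i) / 2`.
  have h1 : chi l m * ((d - m : ℕ) : ℂ) = -Complex.I * (m : ℕ) := by
    linear_combination (1 + Complex.I) / 2 * h' +
      (chi l m * ((d - m : ℕ) : ℂ) - (m : ℕ)) / 2 * Complex.I_sq
  have h2 : d - m = (m : ℕ) := by
    have hn : ‖chi l m‖ = 1 := Complex.norm_eq_one_of_pow_eq_one
      (by rw [chi, ← pow_mul, mul_comm, pow_mul, omega_pow_self, one_pow]) (NeZero.ne d)
    have := congrArg norm h1
    rw [norm_mul, norm_mul, norm_neg, Complex.norm_I, hn, one_mul, one_mul, Complex.norm_natCast,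
      Complex.norm_natCast] at this
    exact_mod_cast this
  rw [h2] at h1
  have h3 : chi l m = -Complex.I := mul_right_cancel₀ (Nat.cast_ne_zero.2 hmv) h1
  have h4 : m + m = 0 := Fin.ext (by
    rw [Fin.val_add, show (m : ℕ) + m = d by have := m.2; omega, Nat.mod_self]; rfl)
  have h5 : chi l m * chi l m = 1 := by rw [← chi_add, h4, chi_zero]
  rw [h3, neg_mul_neg, Complex.I_mul_I] at h5
  norm_num at h5

/-- There are finitely many conditions, and each holds for all small `ε ≠ 0`: for `m = 0` the
overlap tends to `1`, and for `m ≠ 0` the overlap divided by `ε` tends to the nonzero first-order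
term. -/
theorem exists_isFiducial : ∃ ν : Fin d → ℂ, IsFiducial ν := by
  have h : ∀ x : Fin d × Fin d, ∀ᶠ ε : ℝ in nhdsWithin 0 {0}ᶜ,
      overlap (perturb ε) x.1 x.2 ≠ 0 := by
    rintro ⟨m, l⟩
    simp_rw [overlap_perturb]
    by_cases hm : m = 0
    · simp only [hm, if_true]
      have hc : Continuous fun ε : ℝ => (1 : ℂ) + ε * (tilt (0 : Fin d) +
          chi l 0 * star (tilt (-(0 : Fin d))) + ε * overlap tilt 0 l) := by fun_prop
      exact (hc.continuousAt.eventually_ne (by simp)).filter_mono nhdsWithin_le_nhds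
    · simp only [hm, if_false, zero_add]
      have hc : Continuous fun ε : ℝ => tilt m + chi l m * star (tilt (-m)) +
          ε * overlap tilt m l := by fun_prop
      filter_upwards [(hc.continuousAt.eventually_ne (y := 0) (x := 0)
        (by simpa using tilt_add_ne_zero hm l)).filter_mono nhdsWithin_le_nhds,
        self_mem_nhdsWithin] with ε h1 h2
      exact mul_ne_zero (Complex.ofReal_ne_zero.2 h2) h1
  obtain ⟨ε, hε⟩ := (Filter.eventually_all.2 h).exists
  exact exists_isFiducial_of_overlap fun m l => hε (m, l)

end Fiducial

end Steering

end

theorem mainTheorem4 (d : ℕ) [NeZero d] (hd : 2 ≤ d) :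
    -- every pure entangled state of Schmidt rank `d` and every extremal POVM with `d²` outcomes
    (∀ (ι : Type) [Fintype ι] (α : Fin d → ℝ) (I : ι → Matrix (Fin d) (Fin d) ℂ),
      Fintype.card ι = d ^ 2 → Steering.IsSchmidt α → Steering.IsExtremalPOVM I →
        -- the assumptions can be met
        (∃ Q : Steering.Realization d ι, Q.CertifiedBy α I) ∧
        ∀ Q : Steering.Realization d ι, Q.CertifiedBy α I →
          -- the guessing probability reduces to an optimization over `σ_E` and Eve's measurement
          Steering.guessingProb Q.corr = Steering.reducedGuessingProb α I ∧
          -- if moreover `Tr[I_b ρ_B(α)] = 1/d²` for all `b`, it equals `1/d²`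
          ((∀ b, (I b * Steering.rhoB α).trace = 1 / (d : ℂ) ^ 2) →
            (∀ (S : Steering.Realization d ι)
                (E : ι → Matrix (Fin S.dimE) (Fin S.dimE) ℂ),
              S.corr = Q.corr → E ∈ Steering.povms ι (Fin S.dimE) →
                S.guess E = 1 / (d : ℝ) ^ 2) ∧
            Steering.guessingProb Q.corr = 1 / (d : ℝ) ^ 2 ∧
            Steering.minEntropy Q.corr = 2 * Real.logb 2 d)) ∧
    -- the maximally entangled state with the Weyl-covariant extremal POVM
    Steering.IsSchmidt (Steering.maxEnt d) ∧
    (∃ ν : Fin d → ℂ, Steering.IsFiducial ν) ∧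
    (∀ ν : Fin d → ℂ, Steering.IsFiducial ν →
      Steering.IsExtremalPOVM (Steering.weylPOVM ν) ∧
      (∀ x, (Steering.weylPOVM ν x * Steering.rhoB (Steering.maxEnt d)).trace = 1 / (d : ℂ) ^ 2) ∧
      (∃ Q : Steering.Realization d (Fin d × Fin d),
        Q.CertifiedBy (Steering.maxEnt d) (Steering.weylPOVM ν)) ∧
      ∀ Q : Steering.Realization d (Fin d × Fin d),
        Q.CertifiedBy (Steering.maxEnt d) (Steering.weylPOVM ν) →
          Steering.guessingProb Q.corr = 1 / (d : ℝ) ^ 2 ∧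
          Steering.minEntropy Q.corr = 2 * Real.logb 2 d) := by
  have main : ∀ (ι : Type) [Fintype ι] (α : Fin d → ℝ) (I : ι → Matrix (Fin d) (Fin d) ℂ),
      Fintype.card ι = d ^ 2 → Steering.IsSchmidt α → Steering.IsExtremalPOVM I →
        (∀ b, (I b * Steering.rhoB α).trace = 1 / (d : ℂ) ^ 2) →
          ∀ Q : Steering.Realization d ι, Q.CertifiedBy α I →
            Steering.guessingProb Q.corr = 1 / (d : ℝ) ^ 2 ∧
            Steering.minEntropy Q.corr = 2 * Real.logb 2 d := by
    intro ι _ α I hcard hα hI hu Q hQ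
    -- Having `d²` outcomes matters here only through nonemptiness: without outcomes Eve would have
    -- no measurement.
    have : Nonempty ι := Fintype.card_pos_iff.1 (by rw [hcard]; positivity)
    have h := hQ.guessingProb_eq_of_uniform hd hα hI hu
    exact ⟨h, Steering.minEntropy_eq h⟩
  refine ⟨fun ι _ α I hcard hα hI => ⟨⟨_, Steering.certifiedBy_refRealization hα hI.1 hd⟩,
    fun Q hQ => ⟨hQ.guessingProb_eq hd hα hI, fun hu => ⟨fun S E hS hE =>
      (hQ.of_corr_eq hd hS).guess_eq_of_uniform hd hα hI hu hE, main ι α I hcard hα hI hu Q hQ⟩⟩⟩,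
    Steering.isSchmidt_maxEnt, Steering.exists_isFiducial, fun ν hν => ?_⟩
  have hu := Steering.trace_weylPOVM_mul_rhoB hν.1
  exact ⟨hν.isExtremalPOVM, hu,
    ⟨_, Steering.certifiedBy_refRealization Steering.isSchmidt_maxEnt hν.isExtremalPOVM.1 hd⟩,
    main _ _ _ (by simp [sq]) Steering.isSchmidt_maxEnt hν.isExtremalPOVM hu⟩
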